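/- **Setting.** Let $M$ be a compact $C^\infty$ Riemannian manifold without boundary, of dimension $n$, with its Riemannian distance, and fix a finite smooth atlas $\mathcal A=\{(U,\varphi)\}$ of $M$. Let $0<\theta<1$ and $1\le k\le n-1$. For a function $f$ on a subset of a metric space put $\|f\|_{C^\theta}=\sup_x|f(x)|+\sup_{x\ne y}\frac{|f(x)-f(y)|}{d(x,y)^\theta}$. For a $k$-form $\alpha$ on $M$ write $(\varphi^{-1})^*\alpha=\sum_I a_I^\varphi\,dx_I$ on $\varphi(U)\subset\mathbb R^n$ (sum over increasing multi-indices $I$), and let $\|\alpha\|_{C^\theta}=\max_{(U,\varphi)\in\mathcal A}\max_I\|a_I^\varphi\|_{C^\theta}$, where the norm of $a_I^\varphi$ is taken over $\varphi(U)$ with the Euclidean distance. The form $\alpha$ is of class $C^\theta$ if $\|\alpha\|_{C^\theta}<\infty$. A *$C^1$-immersed $(k+1)$-disk $D$ in $M$ with piecewise $C^1$ boundary* is given by a set $B\subset\mathbb R^{k+1}$ homeomorphic to the closed unit ball and a map $f$ into $M$ that is $C^1$ in a neighbourhood of $B$, with injective differential at every point of $B$, where $\partial B$ is the union of finitely many pieces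 $\psi_j([0,1]^k)$ with the following properties: each $\psi_j$ is $C^1$ on $[0,1]^k$; on the open cube $\psi_j$ is an injective immersion, positively oriented for the boundary orientation of $\partial B$ (outward vector first), with $B$ lying on one side of the piece; the images of the open cube under different $\psi_j$ are disjoint. Write $\partial D=f(\partial B)$ for the boundary set, $|D|=\int_B\sqrt{\det\big(\langle\partial_i f,\partial_l f\rangle\big)}\,dx$ and $|\partial D|=\sum_j\int_{[0,1]^k}\sqrt{\det\big(\langle\partial_i(f\circ\psi_j),\partial_l(f\circ\psi_j)\rangle\big)}\,du$ for the Riemannian volumes, and $\int_{\partial D}\alpha=\sum_j\int_{[0,1]^k}(f\circ\psi_j)^*\alpha$. **Theorem A.** There are constants $\sigma,K>0$, depending only on $M$ (with its Riemannian metric and the fixed atlas), $\theta$ and $k$, such that for every $k$-form $\alpha$ of class $C^\theta$ on $M$ and every $C^1$-immersed $(k+1)$-disk $D$ in $M$ with piecewise $C^1$ boundary satisfying $\max\{\operatorname{diam}(\partial D),|\partial D|\}<\sigma$, one has $$\left|\int_{\partial D}\alpha\right|\le K\,\|\alpha\|_{C^\theta}\,|\partial D|^{1-\theta}\,|D|^\theta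 .$$ -/

import Mathlib

open MeasureTheory Set Manifold Bundle
open scoped ENNReal NNReal Topology ContDiff

noncomputable section

/-- The closed unit cube `[0,1]^k`. -/
def unitCube (k : ℕ) : Set (Fin k → ℝ) := Icc 0 1

/-- `ν` points out of `B` at `p`: moving from `p` in direction `ν` leaves `B` at once, moving in
direction `-ν` enters the interior of `B` at once. -/
def PointsOutward {k : ℕ} (B : Set (Fin (k + 1) → ℝ)) (p ν : Fin (k + 1) → ℝ) : Prop :=
  ∀ᶠ t : ℝ in 𝓝[>] 0, p + t • ν ∉ B ∧ p - t • ν ∈ interior B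

/-- A `(k+1)`-disk with piecewise `C^1` boundary in `ℝ^(k+1)`: a set homeomorphic to the closed
unit ball, whose boundary is cut into finitely many `C^1` pieces. Each piece is a `C^1` image of the
closed cube `[0,1]^k`. In the open cube the parametrization is injective, immersive and positively
oriented for the boundary orientation (outward vector first); on the boundary of the cube it may
degenerate, so that triangular pieces and the like are included. The open pieces do not overlap. -/
structure DiskDomain (k : ℕ) where
  /-- The underlying compact set. -/
  carrier : Set (Fin (k + 1) → ℝ)
  homeo_ball : Nonempty (carrier ≃ₜ Metric.closedBall (0 : EuclideanSpace ℝ (Fin (k + 1))) 1)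
  /-- The number of boundary pieces. -/
  numPieces : ℕ
  /-- The parametrizations of the boundary pieces. -/
  piece : Fin numPieces → (Fin k → ℝ) → (Fin (k + 1) → ℝ)
  contDiffOn_piece : ∀ j, ContDiffOn ℝ 1 (piece j) (unitCube k)
  frontier_eq : frontier carrier = ⋃ j, piece j '' unitCube k
  injOn_piece : ∀ j, InjOn (piece j) (interior (unitCube k))
  disjoint_pieces : ∀ i j, i ≠ j →
    Disjoint (piece i '' interior (unitCube k)) (piece j '' interior (unitCube k))
  /-- A positive determinant also forces the differential of the piece to be injective. -/
  oriented : ∀ j, ∀ u ∈ interior (unitCube k), ∃ ν : Fin (k + 1) → ℝ,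
    PointsOutward carrier (piece j u) ν ∧
      0 < Matrix.det (Matrix.of (Fin.cons ν fun i : Fin k =>
        fderivWithin ℝ (piece j) (unitCube k) u (Pi.single i 1)))

section Manifold

variable {n : ℕ} {M : Type*} [TopologicalSpace M] [ChartedSpace (EuclideanSpace ℝ (Fin n)) M]

/-- A differential `k`-form on `M` (no regularity). -/
abbrev DiffForm (n : ℕ) (M : Type*) [TopologicalSpace M]
    [ChartedSpace (EuclideanSpace ℝ (Fin n)) M] (k : ℕ) : Type _ :=
  (x : M) → (TangentSpace (𝓡 n) x) [⋀^Fin k]→L[ℝ] ℝ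

/-- The coefficient `a_I` of `(φ⁻¹)^* α = ∑_I a_I dx_I` in the chart `φ`, for an increasing
multi-index `I`. -/
def DiffForm.coeff {k : ℕ} (α : DiffForm n M k)
    (φ : OpenPartialHomeomorph M (EuclideanSpace ℝ (Fin n))) (I : Fin k ↪o Fin n)
    (y : EuclideanSpace ℝ (Fin n)) : ℝ :=
  α (φ.symm y) fun i => mfderiv (𝓡 n) (𝓡 n) φ.symm y (EuclideanSpace.single (I i) (1 : ℝ))

/-- The `C^θ` norm `sup |f| + H_θ(f)` of a function on a set, possibly infinite. -/
def holderNormOn {X : Type*} [PseudoEMetricSpace X] (θ : ℝ≥0) (s : Set X) (f : X → ℝ) : ℝ≥0∞ :=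
  (⨆ x ∈ s, ‖f x‖ₑ) + eHolderNorm θ (fun x : s => f x)

/-- `A` is a finite smooth atlas of the smooth manifold `M`. -/
def IsFiniteAtlas (A : Set (OpenPartialHomeomorph M (EuclideanSpace ℝ (Fin n)))) : Prop :=
  A.Finite ∧ A ⊆ IsManifold.maximalAtlas (𝓡 n) ∞ M ∧ ∀ x : M, ∃ φ ∈ A, x ∈ φ.source

/-- The `C^θ` norm of a form with respect to an atlas: the maximum over the charts and over the
multi-indices of the `C^θ` norms of the coefficients on the image of the chart. The form is of
class `C^θ` when this is finite. -/
def DiffForm.holderNorm {k : ℕ} (A : Set (OpenPartialHomeomorph M (EuclideanSpace ℝ (Fin n))))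
    (θ : ℝ≥0) (α : DiffForm n M k) : ℝ≥0∞ :=
  ⨆ φ ∈ A, ⨆ I : Fin k ↪o Fin n, holderNormOn θ φ.target (α.coeff φ I)

/-- A `C^1`-immersed `(k+1)`-disk in `M` with piecewise `C^1` boundary. Being `C^1` at each point
of the compact domain is the same as being `C^1` in a neighbourhood of it. -/
structure ImmersedDisk (n : ℕ) (M : Type*) [TopologicalSpace M]
    [ChartedSpace (EuclideanSpace ℝ (Fin n)) M] (k : ℕ) extends DiskDomain k where
  /-- The immersion; its values away from the domain play no role. -/
  toFun : (Fin (k + 1) → ℝ) → M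
  contMDiffAt : ∀ x ∈ carrier, ContMDiffAt 𝓘(ℝ, Fin (k + 1) → ℝ) (𝓡 n) 1 toFun x
  immersion : ∀ x ∈ carrier,
    Function.Injective (mfderiv 𝓘(ℝ, Fin (k + 1) → ℝ) (𝓡 n) toFun x)

namespace ImmersedDisk

variable {k : ℕ} (D : ImmersedDisk n M k)

/-- The set `∂D` in `M`. -/
def boundary : Set M := D.toFun '' frontier D.carrier

/-- The `i`-th coordinate vector of the boundary piece `j` of `D`, that is `∂(f ∘ ψ_j)/∂u_i`. -/
def boundaryVec (j : Fin D.numPieces) (u : Fin k → ℝ) (i : Fin k) :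
    TangentSpace (𝓡 n) (D.toFun (D.piece j u)) :=
  mfderiv 𝓘(ℝ, Fin (k + 1) → ℝ) (𝓡 n) D.toFun (D.piece j u)
    (fderivWithin ℝ (D.piece j) (unitCube k) u (Pi.single i 1))

/-- The integral `∫_{∂D} α`. -/
def boundaryIntegral (α : DiffForm n M k) : ℝ :=
  ∑ j, ∫ u in unitCube k, α (D.toFun (D.piece j u)) (D.boundaryVec j u)

variable [RiemannianBundle (fun x : M => TangentSpace (𝓡 n) x)]

/-- The Riemannian `(k+1)`-volume `|D|`. -/
def vol : ℝ≥0∞ :=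
  ∫⁻ x in D.carrier, ENNReal.ofReal (Real.sqrt (Matrix.det (Matrix.gram ℝ
    fun i : Fin (k + 1) => (mfderiv 𝓘(ℝ, Fin (k + 1) → ℝ) (𝓡 n) D.toFun x
      (Pi.single i (1 : ℝ) : Fin (k + 1) → ℝ) : TangentSpace (𝓡 n) (D.toFun x)))))

/-- The Riemannian `k`-volume `|∂D|`. -/
def boundaryVol : ℝ≥0∞ :=
  ∑ j, ∫⁻ u in unitCube k,
    ENNReal.ofReal (Real.sqrt (Matrix.det (Matrix.gram ℝ (D.boundaryVec j u))))

end ImmersedDisk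

end Manifold

end

/-! The estimate is an interpolation between a trivial bound and Stokes' formula. A partition of
unity subordinate to the atlas reduces `α` to finitely many terms `χ a dx_I` with `a` of class `C^θ`
and norm `H`. At scale `ε ≤ 1` replace `a` by a smooth `F` with `|F - a| ≤ 2 H ε^θ` and `|dF| ≤ H
ε^(θ-1)`. The error form contributes at most a multiple of `H ε^θ |∂D|` to the boundary integral; by
Stokes the regular part is the integral of `d(χ F) ∧ dx_I` over `D`, at most a multiple of `H
ε^(θ-1) |D|`. For `|D| < |∂D|` the choice `ε = |D| / |∂D|` makes both terms equal to `|∂D|^(1-θ)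
|D|^θ`, up to constants. For `|D| ≥ |∂D|` the sup bound `H |∂D|` is already good enough. This is
`le_rpow_mul_rpow_of_forall_le`, fed by `exists_contDiff_approx_of_holder` and
`ofReal_abs_wedgeIntegral_le_of_holder`.

Most of the work is Stokes' formula for a disk whose boundary is only piecewise `C^1`, with pieces
that may degenerate at the edges. The Gauss formula `DiskDomain.integral_fderiv_single` is proved by
slicing along a coordinate axis. By Sard's theorem in equal dimensions almost every line parallel to
the axis meets the boundary in finitely many transversal points off the edges. There the orientation
condition makes the sign of `det (e_i, ∂ψ)` tell whether the line leaves or enters the domain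
(`pointsOutward_of_detCons_pos`), so the integral over the line is a signed sum of boundary values.
The area formula with multiplicities turns the integral of these sums into integrals over the cubes.

For `b dg₁ ∧ … ∧ dg_k` apply Gauss to `b X`, with `X` the cross product of the gradients of the
`g_l`: it is divergence free when the `g_l` are `C^2`, and mollification brings the formula down to
`C^1`, which is all that composition with a `C^1` immersion offers. Volumes enter through
`abs_det_le_sqrt_det_gram`. -/

/-! ### One-dimensional Gauss formula -/

/-- The fundamental theorem of calculus on a compact subset of the line whose frontier consists of
finitely many one-sided end points: `s t = 1` at right end points and `s t = -1` at left ones. -/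
theorem setIntegral_eq_sum_of_one_sided {S : Set ℝ} (hS : IsCompact S) (T : Finset ℝ) (s : ℝ → ℝ)
    (hT : frontier S ⊆ T)
    (hs : ∀ t ∈ T,
      (s t = 1 ∧ (∀ᶠ y in 𝓝[>] t, y ∉ S) ∧ ∀ᶠ y in 𝓝[<] t, y ∈ S) ∨
      (s t = -1 ∧ (∀ᶠ y in 𝓝[<] t, y ∉ S) ∧ ∀ᶠ y in 𝓝[>] t, y ∈ S))
    {g g' : ℝ → ℝ} (hg : ∀ x, HasDerivAt g (g' x) x) (hg' : Continuous g') :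
    ∫ x in S, g' x = ∑ t ∈ T, s t * g t := by
  classical
  -- the step functions whose signed sum is the indicator of `S`
  set e : ℝ → ℝ → ℝ := fun t x =>
    if s t = 1 then (if x ≤ t then 1 else 0) else (if x < t then 1 else 0) with he
  have e_ne : ∀ t x, x ≠ t → ∀ᶠ y in 𝓝 x, e t y = e t x := by
    intro t x hxt
    rcases lt_or_gt_of_ne hxt with h | h
    · filter_upwards [eventually_lt_nhds h] with y hy
      simp [he, hy, h, hy.le, h.le]
    · filter_upwards [eventually_gt_nhds h] with y hy
      simp [he, hy.not_gt, h.not_gt, hy.not_ge, h.not_ge]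
  set χ : ℝ → ℝ := S.indicator 1 with hχ
  have memS : ∀ t ∈ T, t ∈ S := by
    intro t ht
    rcases hs t ht with ⟨-, -, h⟩ | ⟨-, -, h⟩
    · exact hS.isClosed.mem_of_frequently_of_tendsto h.frequently
        (Filter.tendsto_id.mono_left nhdsWithin_le_nhds)
    · exact hS.isClosed.mem_of_frequently_of_tendsto h.frequently
        (Filter.tendsto_id.mono_left nhdsWithin_le_nhds)
  -- Since `t ∈ S` in both cases, a right end point needs the closed half line and a left end point
  -- the open one: with this choice `χ - s t * e t` does not jump at `t`, not even in its value at
  -- `t`.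
  have key : ∀ t ∈ T, ∀ᶠ y in 𝓝 t, χ y - s t * e t y = χ t - s t * e t t := by
    intro t ht
    have h1 := memS t ht
    rcases hs t ht with ⟨h, hr, hl⟩ | ⟨h, hl, hr⟩
    · have hl' : ∀ᶠ y in 𝓝[<] t, χ y - s t * e t y = χ t - s t * e t t := by
        filter_upwards [hl, self_mem_nhdsWithin] with y hy hyt
        simp [he, h, h1, hχ, hy, (show y < t from hyt).le]
      have hr' : ∀ᶠ y in 𝓝[>] t, χ y - s t * e t y = χ t - s t * e t t := by
        filter_upwards [hr, self_mem_nhdsWithin] with y hy hyt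
        simp [he, h, h1, hχ, hy, not_le.2 (show t < y from hyt)]
      rw [← nhdsLT_sup_nhdsGE, ← Ioi_insert, nhdsWithin_insert]
      simp only [Filter.eventually_sup, Filter.eventually_pure]
      exact ⟨hl', trivial, hr'⟩
    · have hn : ¬ ((-1 : ℝ) = 1) := by norm_num
      have hl' : ∀ᶠ y in 𝓝[<] t, χ y - s t * e t y = χ t - s t * e t t := by
        filter_upwards [hl, self_mem_nhdsWithin] with y hy hyt
        simp [he, h, h1, hχ, hy, (show y < t from hyt), hn]
      have hr' : ∀ᶠ y in 𝓝[>] t, χ y - s t * e t y = χ t - s t * e t t := by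
        filter_upwards [hr, self_mem_nhdsWithin] with y hy hyt
        simp [he, h, h1, hχ, hy, (show t < y from hyt).not_gt, hn]
      rw [← nhdsLT_sup_nhdsGE, ← Ioi_insert, nhdsWithin_insert]
      simp only [Filter.eventually_sup, Filter.eventually_pure]
      exact ⟨hl', trivial, hr'⟩
  set q : ℝ → ℝ := fun x => χ x - ∑ t ∈ T, s t * e t x with hq
  -- All jumps of `χ` are compensated, so `q` is constant on the connected line; its value is read
  -- off at a point to the right of `S` and `T`.
  have hloc : IsLocallyConstant q := by
    rw [IsLocallyConstant.iff_eventually_eq]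
    intro x
    have hsum : ∀ T' : Finset ℝ, x ∉ T' →
        ∀ᶠ y in 𝓝 x, ∑ t ∈ T', s t * e t y = ∑ t ∈ T', s t * e t x := by
      intro T' hx
      have : ∀ᶠ y in 𝓝 x, ∀ t ∈ T', e t y = e t x := by
        rw [Filter.eventually_all_finset]
        intro t ht
        exact e_ne t x (fun h => hx (h ▸ ht))
      filter_upwards [this] with y hy
      exact Finset.sum_congr rfl fun t ht => by rw [hy t ht]
    by_cases hx : x ∈ T
    · filter_upwards [key x hx, hsum (T.erase x) (Finset.notMem_erase x T)] with y h1 h2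
      simp only [hq, ← Finset.add_sum_erase T _ hx, h2]
      linarith
    · have hχ' : ∀ᶠ y in 𝓝 x, χ y = χ x := by
        by_cases hxS : x ∈ S
        · have : x ∈ interior S := by
            by_contra h
            exact hx (hT ⟨subset_closure hxS, h⟩)
          filter_upwards [mem_interior_iff_mem_nhds.1 this] with y hy
          simp [hχ, hy, hxS]
        · filter_upwards [hS.isClosed.isOpen_compl.mem_nhds hxS] with y hy
          simp [hχ, show y ∉ S from hy, hxS]
      filter_upwards [hχ', hsum T hx] with y h1 h2
      simp [hq, h1, h2]
  obtain ⟨R₁, hR₁⟩ := hS.bddAbove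
  obtain ⟨R₂, hR₂⟩ := T.bddAbove
  obtain ⟨R₃, hR₃⟩ := hS.bddBelow
  obtain ⟨R₄, hR₄⟩ := T.bddBelow
  set b := max R₁ R₂ + 1 with hb
  set a := min R₃ R₄ - 1 with ha
  have hSb : ∀ x ∈ S, x < b := fun x hx => by
    have := hR₁ hx; have := le_max_left R₁ R₂; linarith
  have hTb : ∀ x ∈ T, x < b := fun x hx => by
    have := hR₂ hx; have := le_max_right R₁ R₂; linarith
  have hSa : ∀ x ∈ S, a < x := fun x hx => by
    have := hR₃ hx; have := min_le_left R₃ R₄; linarith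
  have hTa : ∀ x ∈ T, a < x := fun x hx => by
    have := hR₄ hx; have := min_le_right R₃ R₄; linarith
  have hqb : q b = 0 := by
    have h1 : b ∉ S := fun h => (hSb b h).false
    have h2 : ∑ t ∈ T, s t * e t b = 0 :=
      Finset.sum_eq_zero fun t ht => by simp [he, (hTb t ht).not_ge, (hTb t ht).not_gt]
    simp [hq, hχ, h1, h2]
  have hq0 : ∀ x, χ x = ∑ t ∈ T, s t * e t x := fun x => by
    have := hloc.apply_eq_of_preconnectedSpace x b
    rw [hqb] at this
    simp only [hq] at this
    linarith
  -- Read at a point to the left of everything, the identity says that the signs cancel; this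
  -- removes the terms `g a` at the end.
  have hsum0 : ∑ t ∈ T, s t = 0 := by
    have h1 : a ∉ S := fun h => (hSa a h).false
    have h2 := hq0 a
    rw [hχ, indicator_of_notMem h1] at h2
    rw [h2]
    exact Finset.sum_congr rfl fun t ht => by simp [he, hTa t ht, (hTa t ht).le]
  have e_ae : ∀ t, (fun x => e t x * g' x) =ᵐ[volume] (Iic t).indicator g' := by
    intro t
    have : ∀ᵐ x : ℝ, x ≠ t := by simp [ae_iff]
    filter_upwards [this] with x hx
    by_cases h : x ≤ t
    · simp [he, h, lt_of_le_of_ne h hx]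
    · simp [he, h, (not_le.1 h).not_gt]
  calc ∫ x in S, g' x = ∫ x in Ioc a b, χ x * g' x := by
        have h1 : (fun x => χ x * g' x) = S.indicator g' := by
          ext x
          by_cases h : x ∈ S <;> simp [hχ, h]
        rw [h1, setIntegral_indicator hS.measurableSet,
          inter_eq_self_of_subset_right (show S ⊆ Ioc a b from
            fun x hx => ⟨hSa x hx, (hSb x hx).le⟩)]
    _ = ∫ x in Ioc a b, ∑ t ∈ T, s t * ((Iic t).indicator g' x) := by
        have : ∀ᵐ x : ℝ, ∀ t ∈ T, e t x * g' x = (Iic t).indicator g' x := by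
          rw [Filter.eventually_all_finset]
          exact fun t _ => e_ae t
        refine integral_congr_ae (ae_restrict_of_ae ?_)
        filter_upwards [this] with x hx
        rw [hq0, Finset.sum_mul]
        exact Finset.sum_congr rfl fun t ht => by rw [mul_assoc, hx t ht]
    _ = ∑ t ∈ T, s t * ∫ x in Ioc a b, (Iic t).indicator g' x := by
        rw [integral_finsetSum]
        · simp_rw [integral_const_mul]
        · intro t _
          refine Integrable.const_mul ?_ _
          refine Integrable.indicator ?_ measurableSet_Iic
          exact (hg'.integrableOn_Icc (a := a) (b := b)).mono_set Ioc_subset_Icc_self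
    _ = ∑ t ∈ T, s t * (g t - g a) := by
        refine Finset.sum_congr rfl fun t ht => ?_
        rw [setIntegral_indicator measurableSet_Iic]
        have : Ioc a b ∩ Iic t = Ioc a t := by
          ext x
          simp only [mem_inter_iff, mem_Ioc, mem_Iic]
          have := hTb t ht
          exact ⟨fun h => ⟨h.1.1, h.2⟩, fun h => ⟨⟨h.1, by linarith⟩, h.2⟩⟩
        rw [this, ← intervalIntegral.integral_of_le (hTa t ht).le,
          intervalIntegral.integral_eq_sub_of_hasDerivAt (fun x _ => hg x)
            (hg'.intervalIntegrable _ _)]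
    _ = ∑ t ∈ T, s t * g t := by
        simp_rw [mul_sub]
        rw [Finset.sum_sub_distrib, ← Finset.sum_mul, hsum0]
        simp

/-! ### Area formula with signs and multiplicities -/

section AreaFormula

variable {E : Type*} [NormedAddCommGroup E] [NormedSpace ℝ E] [FiniteDimensional ℝ E]
  [MeasurableSpace E] [BorelSpace E] (μ : Measure E) [μ.IsAddHaarMeasure]

/-- A map with invertible derivative is injective on each set of a countable measurable
partition. -/
theorem exists_partition_injOn_of_hasFDerivWithinAt {f : E → E} {f' : E → E →L[ℝ] E} {s : Set E}
    (hf' : ∀ x ∈ s, HasFDerivWithinAt f (f' x) s x) (hdet : ∀ x ∈ s, (f' x).det ≠ 0) :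
    ∃ t : ℕ → Set E, Pairwise (Function.onFun Disjoint t) ∧ (∀ n, MeasurableSet (t n)) ∧
      s ⊆ ⋃ n, t n ∧ ∀ n, InjOn f (s ∩ t n) := by
  classical
  -- A map within `r < ‖A⁻¹‖⁻¹` of an invertible `A` is injective. The value 1 for singular `A` is a
  -- dummy: the maps chosen by the partition are derivatives at points of `s`.
  have hr : ∀ A : E →L[ℝ] E, ∃ r : ℝ≥0, r ≠ 0 ∧ (A.det ≠ 0 → ∀ t : Set E,
      ApproximatesLinearOn f A t r → InjOn f t) := by
    intro A
    by_cases hA : A.det = 0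
    · exact ⟨1, one_ne_zero, fun h => absurd hA h⟩
    rcases subsingleton_or_nontrivial E with hE | hE
    · exact ⟨1, one_ne_zero, fun _ t _ x _ y _ _ => Subsingleton.elim x y⟩
    set B := A.toContinuousLinearEquivOfDetNeZero hA with hB
    have hpos : 0 < ‖(B.symm : E →L[ℝ] E)‖₊⁻¹ := by
      have := B.norm_symm_pos
      exact inv_pos.2 this
    refine ⟨‖(B.symm : E →L[ℝ] E)‖₊⁻¹ / 2, (half_pos hpos).ne', fun _ t ht => ?_⟩
    have hAB : (B : E →L[ℝ] E) = A := by ext; simp [hB]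
    rw [← hAB] at ht
    exact ht.injOn (Or.inr (half_lt_self hpos))
  choose r hr0 hr using hr
  rcases s.eq_empty_or_nonempty with rfl | hne
  · exact ⟨fun _ => ∅, fun _ _ _ => by simp [Function.onFun], fun _ => MeasurableSet.empty,
      by simp, fun _ => by simp⟩
  obtain ⟨t, A, ht1, ht2, ht3, ht4, ht5⟩ :=
    exists_partition_approximatesLinearOn_of_hasFDerivWithinAt f s f' hf' r hr0
  refine ⟨t, ht1, ht2, ht3, fun n => ?_⟩
  obtain ⟨y, hy, hAy⟩ := ht5 hne n
  exact hr (A n) (hAy ▸ hdet y hy) _ (ht4 n)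

/-- Change of variables with multiplicities, for a finite family of maps with nonzero Jacobian. -/
theorem exists_integral_eq_sum_integral_det {ι : Type*} [Fintype ι] {f : ι → E → E}
    {f' : ι → E → E →L[ℝ] E} {s : ι → Set E} (hs : ∀ i, MeasurableSet (s i))
    (hf' : ∀ i, ∀ x ∈ s i, HasFDerivWithinAt (f i) (f' i x) (s i) x)
    (hdet : ∀ i, ∀ x ∈ s i, (f' i x).det ≠ 0) (h : ι → E → ℝ)
    (hh : ∀ i, IntegrableOn (fun x => (f' i x).det * h i x) (s i) μ) :
    ∃ G : E → ℝ, ∫ y, G y ∂μ = ∑ i, ∫ x in s i, (f' i x).det * h i x ∂μ ∧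
      ∀ (y : E) (F : ι → Finset E), (∀ i x, x ∈ F i ↔ x ∈ s i ∧ f i x = y) →
        G y = ∑ i, ∑ x ∈ F i, (SignType.sign (f' i x).det : ℝ) * h i x := by
  classical
  choose t ht1 ht2 ht3 ht4 using fun i =>
    exists_partition_injOn_of_hasFDerivWithinAt (hf' i) (hdet i)
  -- Weighting by the sign of the Jacobian turns the `|det|` of the change of variables into `det`.
  set c : ι → E → ℝ := fun i x => (SignType.sign (f' i x).det : ℝ) * h i x with hc
  have hcdet : ∀ i x, |(f' i x).det| * c i x = (f' i x).det * h i x := fun i x => by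
    simp only [hc]
    rw [← mul_assoc, abs_mul_sign]
  set p : ι × ℕ → Set E := fun a => s a.1 ∩ t a.1 a.2 with hp
  have hpm : ∀ a, MeasurableSet (p a) := fun a => (hs _).inter (ht2 _ _)
  have hpd : ∀ a, ∀ x ∈ p a, HasFDerivWithinAt (f a.1) (f' a.1 x) (p a) x := fun a x hx =>
    (hf' _ x hx.1).mono inter_subset_left
  have hpi : ∀ a, InjOn (f a.1) (p a) := fun a => ht4 _ _
  set g : ι × ℕ → E → ℝ := fun a y => c a.1 (Function.invFunOn (f a.1) (p a) y) with hg
  have hgf : ∀ a, ∀ x ∈ p a, g a (f a.1 x) = c a.1 x := fun a x hx => by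
    simp only [hg]
    rw [(hpi a).leftInvOn_invFunOn hx]
  have him : ∀ a, MeasurableSet (f a.1 '' p a) := fun a =>
    measurable_image_of_fderivWithin (hpm a) (hpd a) (hpi a)
  set F : ι × ℕ → E → ℝ := fun a => (f a.1 '' p a).indicator (g a) with hF
  have hFi : ∀ a, Integrable (F a) μ := by
    intro a
    rw [integrable_indicator_iff (him a),
      integrableOn_image_iff_integrableOn_abs_det_fderiv_smul μ (hpm a) (hpd a) (hpi a)]
    refine ((hh a.1).mono_set inter_subset_left : IntegrableOn _ (p a) μ).congr_fun
      (fun x hx => ?_) (hpm a)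
    simp only [hgf a x hx, smul_eq_mul, hcdet]
  have hFint : ∀ a, ∫ y, F a y ∂μ = ∫ x in p a, (f' a.1 x).det * h a.1 x ∂μ := by
    intro a
    rw [integral_indicator (him a),
      integral_image_eq_integral_abs_det_fderiv_smul μ (hpm a) (hpd a) (hpi a)]
    refine setIntegral_congr_fun (hpm a) fun x hx => ?_
    simp only [hgf a x hx, smul_eq_mul, hcdet]
  have hFnorm : ∀ a, ∫ y, ‖F a y‖ ∂μ = ∫ x in p a, ‖(f' a.1 x).det * h a.1 x‖ ∂μ := by
    intro a
    have : (fun y => ‖F a y‖) = (f a.1 '' p a).indicator fun y => ‖g a y‖ := by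
      ext y
      simp only [hF]
      rw [norm_indicator_eq_indicator_norm]
    rw [this, integral_indicator (him a),
      integral_image_eq_integral_abs_det_fderiv_smul μ (hpm a) (hpd a) (hpi a)]
    refine setIntegral_congr_fun (hpm a) fun x hx => ?_
    simp only [← hcdet, norm_mul, Real.norm_eq_abs, abs_abs, hgf a x hx, smul_eq_mul]
  have hunion : ∀ i, ⋃ n, p (i, n) = s i := fun i => by
    simp only [hp]
    rw [← inter_iUnion, inter_eq_left]
    exact ht3 i
  have hdisj : ∀ i, Pairwise (Function.onFun Disjoint fun n => p (i, n)) := fun i m n hmn =>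
    (ht1 i hmn).mono inter_subset_right inter_subset_right
  have hsum1 : ∀ i, HasSum (fun n => ∫ x in p (i, n), (f' i x).det * h i x ∂μ)
      (∫ x in s i, (f' i x).det * h i x ∂μ) := fun i => by
    have := hasSum_integral_iUnion (μ := μ) (f := fun x => (f' i x).det * h i x)
      (fun n => hpm (i, n)) (hdisj i) (by rw [hunion]; exact hh i)
    rwa [hunion] at this
  have hsum2 : ∀ i, Summable (fun n => ∫ x in p (i, n), ‖(f' i x).det * h i x‖ ∂μ) := fun i => by
    have := hasSum_integral_iUnion (μ := μ) (f := fun x => ‖(f' i x).det * h i x‖)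
      (fun n => hpm (i, n)) (hdisj i) (by rw [hunion]; exact (hh i).norm)
    exact this.summable
  have hsumm : Summable fun a => ∫ y, ‖F a y‖ ∂μ := by
    rw [summable_prod_of_nonneg fun a => integral_nonneg fun y => norm_nonneg _]
    simp_rw [hFnorm]
    exact ⟨hsum2, .of_finite⟩
  have hmain := hasSum_integral_of_summable_integral_norm hFi hsumm
  -- `G` adds the contributions of all injective pieces. Over a finite fibre each preimage lies in
  -- exactly one piece of its map, so the series reduces to the sum over the fibre; nothing is
  -- claimed about the value at other points.
  refine ⟨fun y => ∑' a, F a y, ?_, ?_⟩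
  · have h1 : HasSum (fun a => ∫ y, F a y ∂μ)
        (∑ i, ∫ x in s i, (f' i x).det * h i x ∂μ) := by
      have hS := hmain.summable
      have := hS.hasSum
      rw [hS.tsum_prod, tsum_fintype] at this
      have hrows : ∑ i, ∫ x in s i, (f' i x).det * h i x ∂μ =
          ∑ i, ∑' n, ∫ y, F (i, n) y ∂μ := by
        refine Finset.sum_congr rfl fun i _ => ((hsum1 i).tsum_eq).symm.trans ?_
        simp_rw [hFint]
      rw [hrows]
      exact this
    exact hmain.unique h1
  · intro y Φ hΦ
    have hFy : ∀ i n, F (i, n) y = ∑ x ∈ Φ i, (t i n).indicator (c i) x := by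
      intro i n
      by_cases hy : y ∈ f i '' p (i, n)
      · obtain ⟨x, hx, rfl⟩ := hy
        have h1 : F (i, n) (f i x) = c i x := by
          simp only [hF]
          rw [indicator_of_mem (mem_image_of_mem _ hx)]
          exact hgf (i, n) x hx
        rw [h1, Finset.sum_eq_single x]
        · rw [indicator_of_mem hx.2]
        · intro z hz hzx
          refine indicator_of_notMem (fun hzt => hzx ?_) _
          have := (hΦ i z).1 hz
          exact hpi (i, n) ⟨this.1, hzt⟩ hx this.2
        · intro hxn
          exact absurd ((hΦ i x).2 ⟨hx.1, rfl⟩) hxn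
      · simp only [hF]
        rw [indicator_of_notMem hy]
        refine (Finset.sum_eq_zero fun x hx => indicator_of_notMem (fun hxt => hy ?_) _).symm
        have := (hΦ i x).1 hx
        exact ⟨x, ⟨this.1, hxt⟩, this.2⟩
    have hone : ∀ i, ∀ x ∈ Φ i, HasSum (fun n => (t i n).indicator (c i) x) (c i x) := by
      intro i x hx
      obtain ⟨n, hn⟩ := mem_iUnion.1 (ht3 i ((hΦ i x).1 hx).1)
      rw [show c i x = (t i n).indicator (c i) x from (indicator_of_mem hn _).symm]
      refine hasSum_single n fun m hm => indicator_of_notMem (fun hxm => ?_) _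
      exact disjoint_left.1 (ht1 i hm) hxm hn
    have hrow : ∀ i, HasSum (fun n => F (i, n) y) (∑ x ∈ Φ i, c i x) := fun i => by
      simp_rw [hFy]
      exact hasSum_sum fun x hx => hone i x hx
    have htot : HasSum (fun a : ι × ℕ => F a y) (∑ i, ∑ x ∈ Φ i, c i x) := by
      have hfin : ∀ i, HasSum (fun a : ι × ℕ => if a.1 = i then F a y else 0)
          (∑ x ∈ Φ i, c i x) := fun i => by
        have hinj : Function.Injective fun n : ℕ => (i, n) := fun m n h => by simpa using h
        refine (hinj.hasSum_iff ?_).1 ?_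
        · intro a ha
          rw [if_neg]
          rintro rfl
          exact ha ⟨a.2, rfl⟩
        · convert hrow i using 2 with n
          simp
      convert hasSum_sum (s := Finset.univ) fun i _ => hfin i using 2 with a
      simp
    exact htot.tsum_eq

end AreaFormula

/-! ### The cube and the conormal determinant -/

section UnitCube

variable {k : ℕ}

theorem isCompact_unitCube : IsCompact (unitCube k) := isCompact_Icc

theorem convex_unitCube : Convex ℝ (unitCube k) := convex_Icc 0 1

theorem interior_unitCube_nonempty : (interior (unitCube k)).Nonempty := by
  refine ⟨fun _ => 1 / 2, ?_⟩
  have h : unitCube k = Set.pi univ fun _ : Fin k => Icc (0 : ℝ) 1 := by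
    ext x
    simp [unitCube, Pi.le_def]
  rw [h, interior_pi_set finite_univ]
  intro i _
  simp only [interior_Icc]
  norm_num

theorem uniqueDiffOn_unitCube : UniqueDiffOn ℝ (unitCube k) :=
  uniqueDiffOn_convex convex_unitCube interior_unitCube_nonempty

theorem volume_unitCube_diff_interior :
    volume (unitCube k \ interior (unitCube k)) = 0 := by
  have h := (convex_unitCube (k := k)).addHaar_frontier volume
  rwa [isCompact_unitCube.isClosed.frontier_eq] at h

theorem interior_unitCube_ae_eq :
    interior (unitCube k) =ᵐ[volume] unitCube k :=
  ae_eq_of_subset_of_measure_ge interior_subset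
    (by
      refine (measure_mono (show unitCube k ⊆ interior (unitCube k) ∪
        (unitCube k \ interior (unitCube k)) by rw [union_sdiff_self]; exact subset_union_right)).trans ?_
      refine (measure_union_le _ _).trans ?_
      rw [volume_unitCube_diff_interior, add_zero])
    isOpen_interior.measurableSet.nullMeasurableSet isCompact_unitCube.measure_lt_top.ne

end UnitCube

section DetCons

variable {k : ℕ}

/-- The linear form `x ↦ det (x, w₀, …, w_{k-1})`. -/
noncomputable def detCons (w : Fin k → Fin (k + 1) → ℝ) : (Fin (k + 1) → ℝ) →L[ℝ] ℝ :=
  LinearMap.toContinuousLinearMap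
    { toFun := fun x => (Matrix.detRowAlternating (R := ℝ) (n := Fin (k + 1))).curryLeft x w
      map_add' := fun x y => by simp only [map_add, AlternatingMap.add_apply]
      map_smul' := fun c x => by simp }

theorem detCons_apply (w : Fin k → Fin (k + 1) → ℝ) (x : Fin (k + 1) → ℝ) :
    detCons w x = Matrix.det (Matrix.of (Fin.cons x w)) := rfl

theorem detCons_self (w : Fin k → Fin (k + 1) → ℝ) (i : Fin k) : detCons w (w i) = 0 := by
  rw [detCons_apply]
  exact Matrix.det_zero_of_row_eq (i := 0) (j := i.succ) (Fin.succ_ne_zero i).symm (by ext; simp)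

/-- For `A` the derivative of a boundary piece, `detCons` is a conormal to the tangent plane:
nonzero values mean transversality, and the sign selects the side. -/
theorem detCons_map (A : (Fin k → ℝ) →L[ℝ] Fin (k + 1) → ℝ) (h : Fin k → ℝ) :
    detCons (fun i => A (Pi.single i 1)) (A h) = 0 := by
  have : A h = ∑ i, h i • A (Pi.single i 1) := by
    conv_lhs => rw [pi_eq_sum_univ' h]
    simp [map_sum, map_smul]
  rw [this, map_sum]
  exact Finset.sum_eq_zero fun i _ => by rw [map_smul, detCons_self, smul_zero]

theorem injective_of_detCons_ne_zero {A : (Fin k → ℝ) →L[ℝ] Fin (k + 1) → ℝ}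
    {x : Fin (k + 1) → ℝ} (hx : detCons (fun i => A (Pi.single i 1)) x ≠ 0) :
    Function.Injective A := by
  rw [injective_iff_map_eq_zero]
  intro h hh
  have hli := Matrix.linearIndependent_rows_of_det_ne_zero hx
  have hli' : LinearIndependent ℝ fun i => A (Pi.single i 1) := by
    have := hli.comp Fin.succ (Fin.succ_injective k)
    exact this
  have h0 : ∑ i, h i • A (Pi.single i 1) = 0 := by
    rw [← hh]
    conv_rhs => rw [pi_eq_sum_univ' h]
    simp [map_sum, map_smul]
  ext i
  exact Fintype.linearIndependent_iff.1 hli' h h0 i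

end DetCons

/-! ### Outward directions at boundary points -/

/-- Without a frontier point the interior and the exterior of `s` would disconnect `t`. This carries
inside and outside along segments from a known outward vector to any other direction on the same
side. -/
theorem IsPreconnected.inter_frontier_of_inter_compl {X : Type*} [TopologicalSpace X] {s t : Set X}
    (ht : IsPreconnected t) (h : (t ∩ s).Nonempty) (h' : (t ∩ sᶜ).Nonempty) :
    (t ∩ frontier s).Nonempty := by
  by_contra hn
  have hsub : t ⊆ interior s ∪ (closure s)ᶜ := fun x hx => by
    by_contra hx'
    simp only [mem_union, mem_compl_iff, not_or, not_not] at hx'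
    exact hn ⟨x, hx, hx'.2, hx'.1⟩
  obtain ⟨x, hxt, hxs⟩ := h
  obtain ⟨y, hyt, hys⟩ := h'
  have hx : x ∈ interior s := (hsub hxt).resolve_right fun h => h (subset_closure hxs)
  have hy : y ∈ (closure s)ᶜ := (hsub hyt).resolve_left fun h => hys (interior_subset h)
  obtain ⟨z, -, hz, hz'⟩ := ht _ _ isOpen_interior isClosed_closure.isOpen_compl hsub
    ⟨x, hxt, hx⟩ ⟨y, hyt, hy⟩
  exact hz' (interior_subset_closure hz)

namespace DiskDomain

variable {k : ℕ} (B : DiskDomain k)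

theorem isCompact_carrier : IsCompact B.carrier := by
  obtain ⟨e⟩ := B.homeo_ball
  have : CompactSpace (Metric.closedBall (0 : EuclideanSpace ℝ (Fin (k + 1))) 1) :=
    isCompact_iff_compactSpace.1 (isCompact_closedBall 0 1)
  exact isCompact_iff_compactSpace.2 e.symm.compactSpace

/-- The derivative of a boundary piece. -/
noncomputable abbrev pieceDeriv (j : Fin B.numPieces) (u : Fin k → ℝ) :
    (Fin k → ℝ) →L[ℝ] Fin (k + 1) → ℝ :=
  fderivWithin ℝ (B.piece j) (unitCube k) u

/-- The coordinate vectors of a boundary piece. -/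
noncomputable abbrev pieceVec (j : Fin B.numPieces) (u : Fin k → ℝ) (i : Fin k) :
    Fin (k + 1) → ℝ :=
  B.pieceDeriv j u (Pi.single i 1)

theorem hasFDerivWithinAt_piece (j : Fin B.numPieces) {u : Fin k → ℝ} (hu : u ∈ unitCube k) :
    HasFDerivWithinAt (B.piece j) (B.pieceDeriv j u) (unitCube k) u :=
  ((B.contDiffOn_piece j).differentiableOn one_ne_zero u hu).hasFDerivWithinAt

theorem hasFDerivAt_piece (j : Fin B.numPieces) {u : Fin k → ℝ}
    (hu : u ∈ interior (unitCube k)) : HasFDerivAt (B.piece j) (B.pieceDeriv j u) u :=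
  (B.hasFDerivWithinAt_piece j (interior_subset hu)).hasFDerivAt (mem_interior_iff_mem_nhds.1 hu)

theorem continuousOn_piece (j : Fin B.numPieces) : ContinuousOn (B.piece j) (unitCube k) :=
  (B.contDiffOn_piece j).continuousOn

theorem continuousOn_pieceDeriv (j : Fin B.numPieces) :
    ContinuousOn (B.pieceDeriv j) (unitCube k) :=
  (B.contDiffOn_piece j).continuousOn_fderivWithin uniqueDiffOn_unitCube le_rfl

theorem continuousOn_pieceVec (j : Fin B.numPieces) (i : Fin k) :
    ContinuousOn (fun u => B.pieceVec j u i) (unitCube k) :=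
  (B.continuousOn_pieceDeriv j).clm_apply continuousOn_const

theorem piece_mem_carrier (j : Fin B.numPieces) {u : Fin k → ℝ} (hu : u ∈ unitCube k) :
    B.piece j u ∈ B.carrier := by
  have h : B.piece j u ∈ frontier B.carrier := by
    rw [B.frontier_eq]
    exact mem_iUnion.2 ⟨j, mem_image_of_mem _ hu⟩
  exact B.isCompact_carrier.isClosed.frontier_subset h

/-- The images of the boundaries of the cubes. -/
def edges : Set (Fin (k + 1) → ℝ) :=
  ⋃ j, B.piece j '' (unitCube k \ interior (unitCube k))

/-- Away from the edges, the boundary is locally the image of a single patch. -/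
theorem eventually_mem_frontier_imp {j : Fin B.numPieces} {u : Fin k → ℝ}
    (hu : u ∈ interior (unitCube k)) (hp : B.piece j u ∉ B.edges) {V : Set (Fin k → ℝ)}
    (hV : V ∈ 𝓝 u) :
    ∀ᶠ x in 𝓝 (B.piece j u), x ∈ frontier B.carrier → ∃ u' ∈ V, B.piece j u' = x := by
  obtain ⟨W, hWV, hWo, huW⟩ := mem_nhds_iff.1 hV
  -- All boundary points coming from other pieces or from parameters outside `W`. The set is closed
  -- and misses the given point, because off the edges the open pieces are disjoint and injective.
  set K : Set (Fin (k + 1) → ℝ) :=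
    (⋃ i ∈ {i | i ≠ j}, B.piece i '' unitCube k) ∪ B.piece j '' (unitCube k \ W) with hK
  have hKc : IsClosed K := by
    refine IsClosed.union ?_ ?_
    · refine (toFinite _).isClosed_biUnion fun i _ => ?_
      exact (isCompact_unitCube.image_of_continuousOn (B.continuousOn_piece i)).isClosed
    · exact ((isCompact_unitCube.diff hWo).image_of_continuousOn
        ((B.continuousOn_piece j).mono sdiff_subset)).isClosed
  have hmem : ∀ i, ∀ u' ∈ unitCube k, B.piece i u' = B.piece j u →
      u' ∈ interior (unitCube k) := by
    intro i u' hu' h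
    by_contra hn
    exact hp (mem_iUnion.2 ⟨i, u', ⟨hu', hn⟩, h⟩)
  have hpK : B.piece j u ∉ K := by
    rintro (h | ⟨u', hu', h⟩)
    · simp only [mem_iUnion] at h
      obtain ⟨i, hij, u', hu', h⟩ := h
      exact disjoint_left.1 (B.disjoint_pieces i j hij) ⟨u', hmem i u' hu' h, h⟩ ⟨u, hu, rfl⟩
    · exact hu'.2 (B.injOn_piece j (hmem j u' hu'.1 h) hu h ▸ huW)
  filter_upwards [hKc.isOpen_compl.mem_nhds hpK] with x hx hxf
  rw [B.frontier_eq] at hxf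
  obtain ⟨i, u', hu', rfl⟩ := mem_iUnion.1 hxf
  by_cases hij : i = j
  · subst hij
    refine ⟨u', hWV ?_, rfl⟩
    by_contra hn
    exact hx (Or.inr ⟨u', ⟨hu', hn⟩, rfl⟩)
  · exact absurd (Or.inl (mem_iUnion₂.2 ⟨i, hij, mem_image_of_mem _ hu'⟩)) hx

/-- Near a boundary point off the edges, the sectors between two transversal directions on the
same side do not meet the boundary. -/
theorem exists_sector_disjoint_frontier {j : Fin B.numPieces} {u : Fin k → ℝ}
    (hu : u ∈ interior (unitCube k)) (hp : B.piece j u ∉ B.edges) {v w : Fin (k + 1) → ℝ}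
    (hv : 0 < detCons (B.pieceVec j u) v) (hw : 0 < detCons (B.pieceVec j u) w) :
    ∃ δ > 0, ∀ t : ℝ, t ≠ 0 → |t| < δ → ∀ x ∈ segment ℝ v w,
      B.piece j u + t • x ∉ frontier B.carrier := by
  set A := B.pieceDeriv j u with hA
  set ℓ := detCons (B.pieceVec j u) with hℓ
  set c := min (ℓ v) (ℓ w) with hc
  have hcpos : 0 < c := lt_min hv hw
  have hℓseg : ∀ x ∈ segment ℝ v w, c ≤ ℓ x := by
    rintro x ⟨a, b, ha, hb, hab, rfl⟩
    rw [map_add, map_smul, map_smul, smul_eq_mul, smul_eq_mul]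
    calc c = a * c + b * c := by rw [← add_mul, hab, one_mul]
      _ ≤ a * ℓ v + b * ℓ w := by
        gcongr
        · exact min_le_left _ _
        · exact min_le_right _ _
  set R := ‖v‖ + ‖w‖ with hR
  have hRseg : ∀ x ∈ segment ℝ v w, ‖x‖ ≤ R := by
    rintro x ⟨a, b, ha, hb, hab, rfl⟩
    refine (norm_add_le _ _).trans ?_
    rw [norm_smul, norm_smul, Real.norm_of_nonneg ha, Real.norm_of_nonneg hb]
    have h1 : a ≤ 1 := by linarith
    have h2 : b ≤ 1 := by linarith
    exact add_le_add (mul_le_of_le_one_left (norm_nonneg _) h1)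
      (mul_le_of_le_one_left (norm_nonneg _) h2)
  have hR0 : 0 ≤ R := by positivity
  obtain ⟨K, hK0, hK⟩ := (A : (Fin k → ℝ) →ₗ[ℝ] Fin (k + 1) → ℝ).exists_antilipschitzWith
    (LinearMap.ker_eq_bot.2 (injective_of_detCons_ne_zero hv.ne'))
  have hKA : ∀ h, ‖h‖ ≤ K * ‖A h‖ := fun h => by
    have := hK.le_mul_dist h 0
    simpa using this
  have hK0' : (0 : ℝ) < K := hK0
  -- The first entry absorbs the linearization error into the lower bound for `A`, giving `‖h‖ ≤ 2 K
  -- |t| R`. The second makes the error in the conormal direction at most half of the lower bound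
  -- `c` for `ℓ` on the segment. The summands 1 keep the denominator positive.
  set ε : ℝ := min (1 / (2 * K)) (c / (4 * K * (R + 1) * (‖ℓ‖ + 1))) with hε
  have hden : 0 < 4 * K * (R + 1) * (‖ℓ‖ + 1) := by positivity
  have hεpos : 0 < ε := lt_min (by positivity) (by positivity)
  have hε1 : K * ε ≤ 1 / 2 := by
    calc K * ε ≤ K * (1 / (2 * K)) := by gcongr; exact min_le_left _ _
      _ = 1 / 2 := by field_simp
  have hε2 : ε * (4 * K * (R + 1) * (‖ℓ‖ + 1)) ≤ c := by
    rw [← le_div_iff₀ hden]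
    exact min_le_right _ _
  have hV : {u' | ‖B.piece j u' - B.piece j u - A (u' - u)‖ ≤ ε * ‖u' - u‖} ∈ 𝓝 u :=
    (B.hasFDerivAt_piece j hu).isLittleO.def hεpos
  have hev := B.eventually_mem_frontier_imp hu hp hV
  obtain ⟨r, hr, hball⟩ := Metric.eventually_nhds_iff.1 hev
  refine ⟨r / (R + 1), by positivity, fun t ht0 ht x hx hfr => ?_⟩
  have htx : ‖t • x‖ ≤ |t| * R := by
    rw [norm_smul, Real.norm_eq_abs]
    gcongr
    exact hRseg x hx
  have habs : 0 < |t| := abs_pos.2 ht0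
  obtain ⟨u', hu', hux⟩ := hball (by
    rw [dist_eq_norm, add_sub_cancel_left]
    refine htx.trans_lt ?_
    rw [lt_div_iff₀ (by positivity)] at ht
    nlinarith) hfr
  simp only [mem_ofPred_eq, hux, add_sub_cancel_left] at hu'
  set h := u' - u with hh
  have h1 : ‖h‖ ≤ 2 * K * (|t| * R) := by
    have h2 : ‖A h‖ ≤ |t| * R + ε * ‖h‖ := by
      have : A h = t • x - (t • x - A h) := by abel
      rw [this]
      exact (norm_sub_le _ _).trans (add_le_add htx hu')
    have h3 : ‖h‖ ≤ K * (|t| * R) + K * ε * ‖h‖ := by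
      calc ‖h‖ ≤ K * ‖A h‖ := hKA h
        _ ≤ K * (|t| * R + ε * ‖h‖) := by gcongr
        _ = _ := by ring
    have h4 : K * ε * ‖h‖ ≤ 1 / 2 * ‖h‖ := by gcongr
    linarith
  -- A boundary point `p + t x` would be `ψ(u')` with `ψ(u') - p` almost tangent; as `ℓ` kills
  -- tangent vectors, `t ℓ(x)` would be of the order of the error only.
  have h5 : |t| * c ≤ ‖ℓ‖ * (ε * (2 * K * (|t| * R))) := by
    calc |t| * c ≤ |t| * ℓ x := by gcongr; exact hℓseg x hx
      _ ≤ |t| * |ℓ x| := by gcongr; exact le_abs_self _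
      _ = ‖ℓ (t • x - A h)‖ := by
        rw [map_sub, detCons_map A h, sub_zero, map_smul, smul_eq_mul, norm_mul,
          Real.norm_eq_abs, Real.norm_eq_abs]
      _ ≤ ‖ℓ‖ * ‖t • x - A h‖ := ℓ.le_opNorm _
      _ ≤ ‖ℓ‖ * (ε * ‖h‖) := by gcongr
      _ ≤ ‖ℓ‖ * (ε * (2 * K * (|t| * R))) := by gcongr
  have h6 : c ≤ ‖ℓ‖ * ε * (2 * K * R) := by
    refine le_of_mul_le_mul_left ?_ habs
    linarith
  have h7 : ‖ℓ‖ * ε * (2 * K * R) ≤ (‖ℓ‖ + 1) * ε * (2 * K * (R + 1)) := by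
    gcongr <;> linarith
  nlinarith

/-- Off the edges, every transversal direction on the positive side points outward. -/
theorem pointsOutward_of_detCons_pos {j : Fin B.numPieces} {u : Fin k → ℝ}
    (hu : u ∈ interior (unitCube k)) (hp : B.piece j u ∉ B.edges) {w : Fin (k + 1) → ℝ}
    (hw : 0 < detCons (B.pieceVec j u) w) : PointsOutward B.carrier (B.piece j u) w := by
  obtain ⟨ν, hν, hdet⟩ := B.oriented j u hu
  obtain ⟨δ, hδ, hsec⟩ := B.exists_sector_disjoint_frontier hu hp (v := ν) hdet hw
  have hpre : ∀ t : ℝ, IsPreconnected ((fun x => B.piece j u + t • x) '' segment ℝ ν w) :=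
    fun t => (convex_segment ν w).isPreconnected.image _ (by fun_prop)
  have hsmall : ∀ᶠ t : ℝ in 𝓝[>] 0, t < δ := nhdsWithin_le_nhds (eventually_lt_nhds hδ)
  filter_upwards [hν, self_mem_nhdsWithin, hsmall] with t ht ht0 htδ
  have ht0' : (0 : ℝ) < t := ht0
  have habs : |t| < δ := by rwa [abs_of_pos ht0']
  -- For `s = t` and `s = -t` the segment from `p + s ν` to `p + s w` misses the frontier, so its
  -- two ends lie on the same side of it.
  have hno : ∀ s : ℝ, s ≠ 0 → |s| < δ →
      ¬ (((fun x => B.piece j u + s • x) '' segment ℝ ν w) ∩ frontier B.carrier).Nonempty := by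
    rintro s hs0 hs ⟨_, ⟨x, hx, rfl⟩, hxf⟩
    exact hsec s hs0 hs x hx hxf
  constructor
  · intro hmem
    refine hno t ht0'.ne' habs (IsPreconnected.inter_frontier_of_inter_compl (hpre t) ?_ ?_)
    · exact ⟨_, ⟨w, right_mem_segment ℝ ν w, rfl⟩, hmem⟩
    · exact ⟨_, ⟨ν, left_mem_segment ℝ ν w, rfl⟩, ht.1⟩
  · have hno' := hno (-t) (neg_ne_zero.2 ht0'.ne') (by rwa [abs_neg])
    have hmem : B.piece j u - t • w ∈ B.carrier := by
      by_contra hn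
      refine hno' (IsPreconnected.inter_frontier_of_inter_compl (hpre (-t)) ?_ ?_)
      · refine ⟨_, ⟨ν, left_mem_segment ℝ ν w, rfl⟩, ?_⟩
        simpa [sub_eq_add_neg] using interior_subset ht.2
      · refine ⟨_, ⟨w, right_mem_segment ℝ ν w, rfl⟩, ?_⟩
        simpa [sub_eq_add_neg] using hn
    by_contra hn
    refine hno' ⟨_, ⟨w, right_mem_segment ℝ ν w, rfl⟩, ?_⟩
    simp only [neg_smul, ← sub_eq_add_neg]
    exact ⟨subset_closure hmem, hn⟩

end DiskDomain

/-! ### Gauss formula by slicing along an axis -/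

namespace DiskDomain

variable {k : ℕ} (B : DiskDomain k)

/-- The projection of `ℝ^(k+1)` along the `i`-th axis. -/
noncomputable def removeCoord (i : Fin (k + 1)) : (Fin (k + 1) → ℝ) →L[ℝ] Fin k → ℝ :=
  ContinuousLinearMap.pi fun l => ContinuousLinearMap.proj (i.succAbove l)

@[simp]
theorem removeCoord_apply (i : Fin (k + 1)) (x : Fin (k + 1) → ℝ) (l : Fin k) :
    removeCoord i x l = x (i.succAbove l) := rfl

theorem detCons_single (w : Fin k → Fin (k + 1) → ℝ) (i : Fin (k + 1)) :
    detCons w (Pi.single i 1) =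
      (-1) ^ (i : ℕ) * Matrix.det (Matrix.of fun a b => w a (i.succAbove b)) := by
  rw [detCons_apply, Matrix.det_succ_row_zero, Finset.sum_eq_single i]
  · simp only [Matrix.of_apply, Fin.cons_zero, Pi.single_eq_same, mul_one]
    rfl
  · intro l _ hl
    simp [Pi.single_eq_of_ne hl]
  · simp

/-- The derivative of a boundary piece followed by the projection along the `i`-th axis. -/
noncomputable abbrev projDeriv (i : Fin (k + 1)) (j : Fin B.numPieces) (u : Fin k → ℝ) :
    (Fin k → ℝ) →L[ℝ] Fin k → ℝ :=
  (removeCoord i).comp (B.pieceDeriv j u)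

/-- Links the two roles of the determinant: its sign is the side to which `e_i` points, and up to
`(-1)^i` it is the Jacobian of the projected piece. Critical points of the projection are those
where `e_i` is tangent. -/
theorem detCons_pieceVec_single (i : Fin (k + 1)) (j : Fin B.numPieces) (u : Fin k → ℝ) :
    detCons (B.pieceVec j u) (Pi.single i 1) = (-1) ^ (i : ℕ) * (B.projDeriv i j u).det := by
  rw [detCons_single]
  congr 1
  rw [ContinuousLinearMap.det, ← LinearMap.det_toMatrix', ← Matrix.det_transpose]
  congr 1

/-- The values of the projection along the `i`-th axis that are critical or hit by the edges. -/
def criticalValues (i : Fin (k + 1)) : Set (Fin k → ℝ) :=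
  ⋃ j, ((fun u => removeCoord i (B.piece j u)) '' (unitCube k \ interior (unitCube k)) ∪
    (fun u => removeCoord i (B.piece j u)) ''
      {u | u ∈ interior (unitCube k) ∧ (B.projDeriv i j u).det = 0})

theorem hasFDerivWithinAt_proj (i : Fin (k + 1)) (j : Fin B.numPieces) {u : Fin k → ℝ}
    (hu : u ∈ unitCube k) :
    HasFDerivWithinAt (fun u => removeCoord i (B.piece j u)) (B.projDeriv i j u) (unitCube k) u :=
  (removeCoord i).hasFDerivAt.comp_hasFDerivWithinAt u (B.hasFDerivWithinAt_piece j hu)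

/-- Faces of the cube are null and a differentiable map between spaces of equal dimension keeps them
null; the critical part is Sard's theorem in equal dimension, where differentiability suffices. -/
theorem volume_criticalValues (i : Fin (k + 1)) : volume (B.criticalValues i) = 0 := by
  refine measure_iUnion_null fun j => measure_union_null ?_ ?_
  · refine addHaar_image_eq_zero_of_differentiableOn_of_addHaar_eq_zero volume (fun u hu => ?_)
      volume_unitCube_diff_interior
    exact ((B.hasFDerivWithinAt_proj i j hu.1).mono sdiff_subset).differentiableWithinAt
  · refine addHaar_image_eq_zero_of_det_fderivWithin_eq_zero volume
      (f' := B.projDeriv i j) (fun u hu => ?_) fun u hu => hu.2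
    exact (B.hasFDerivWithinAt_proj i j (interior_subset hu.1)).mono
      fun v hv => interior_subset hv.1

/-- The regular points of a piece for the projection along the `i`-th axis. -/
def regularPoints (i : Fin (k + 1)) (j : Fin B.numPieces) : Set (Fin k → ℝ) :=
  {u | u ∈ interior (unitCube k) ∧ (B.projDeriv i j u).det ≠ 0}

theorem continuousOn_det_projDeriv (i : Fin (k + 1)) (j : Fin B.numPieces) :
    ContinuousOn (fun u => (B.projDeriv i j u).det) (unitCube k) := by
  have h : ContinuousOn (fun u => B.projDeriv i j u) (unitCube k) :=
    continuousOn_const.clm_comp (B.continuousOn_pieceDeriv j)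
  exact ContinuousLinearMap.continuous_det.comp_continuousOn h

theorem isOpen_regularPoints (i : Fin (k + 1)) (j : Fin B.numPieces) :
    IsOpen (B.regularPoints i j) :=
  ((B.continuousOn_det_projDeriv i j).mono interior_subset).isOpen_inter_preimage isOpen_interior
    isOpen_ne

theorem mem_regularPoints_of_notMem_criticalValues {i : Fin (k + 1)} {j : Fin B.numPieces}
    {u : Fin k → ℝ} (hu : u ∈ unitCube k)
    (hy : removeCoord i (B.piece j u) ∉ B.criticalValues i) : u ∈ B.regularPoints i j := by
  by_contra hn
  refine hy (mem_iUnion.2 ⟨j, ?_⟩)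
  by_cases hi : u ∈ interior (unitCube k)
  · refine Or.inr ⟨u, ⟨hi, ?_⟩, rfl⟩
    by_contra hd
    exact hn ⟨hi, hd⟩
  · exact Or.inl ⟨u, ⟨hu, hi⟩, rfl⟩

theorem notMem_edges_of_notMem_criticalValues {i : Fin (k + 1)} {x : Fin (k + 1) → ℝ}
    (hx : removeCoord i x ∉ B.criticalValues i) : x ∉ B.edges := by
  intro h
  obtain ⟨j, u, hu, rfl⟩ := mem_iUnion.1 h
  exact hx (mem_iUnion.2 ⟨j, Or.inl ⟨u, hu, rfl⟩⟩)

/-- An infinite fibre would accumulate in the compact cube at a point of the same fibre. That point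
is regular, so nearby points take values other than `y`. -/
theorem finite_fiber {i : Fin (k + 1)} {y : Fin k → ℝ} (hy : y ∉ B.criticalValues i)
    (j : Fin B.numPieces) :
    {u | u ∈ B.regularPoints i j ∧ removeCoord i (B.piece j u) = y}.Finite := by
  by_contra hinf
  have hsub : {u | u ∈ B.regularPoints i j ∧ removeCoord i (B.piece j u) = y} ⊆
      {u | u ∈ unitCube k ∧ removeCoord i (B.piece j u) = y} :=
    fun u hu => ⟨interior_subset hu.1.1, hu.2⟩
  have hcont : ContinuousOn (fun u => removeCoord i (B.piece j u)) (unitCube k) :=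
    (removeCoord i).continuous.comp_continuousOn (B.continuousOn_piece j)
  have hcomp : IsCompact {u | u ∈ unitCube k ∧ removeCoord i (B.piece j u) = y} :=
    isCompact_unitCube.of_isClosed_subset
      (hcont.preimage_isClosed_of_isClosed isCompact_unitCube.isClosed isClosed_singleton)
      fun u hu => hu.1
  obtain ⟨u, hu, hacc⟩ := Set.Infinite.exists_accPt_of_subset_isCompact hinf hcomp hsub
  have hreg := B.mem_regularPoints_of_notMem_criticalValues hu.1 (by rw [hu.2]; exact hy)
  have hd : HasFDerivAt (fun u => removeCoord i (B.piece j u)) (B.projDeriv i j u) u :=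
    (B.hasFDerivWithinAt_proj i j hu.1).hasFDerivAt (mem_interior_iff_mem_nhds.1 hreg.1)
  have hne := hd.eventually_ne (c := y) (by
    set e := (B.projDeriv i j u).toContinuousLinearEquivOfDetNeZero hreg.2 with he
    exact ⟨_, e.antilipschitz⟩)
  rw [accPt_iff_frequently] at hacc
  rw [eventually_nhdsWithin_iff] at hne
  obtain ⟨z, ⟨hz1, hz2⟩, hz3⟩ := (hacc.and_eventually hne).exists
  exact hz3 hz1 hz2.2

theorem not_pointsOutward_neg {C : Set (Fin (k + 1) → ℝ)} {p ν : Fin (k + 1) → ℝ}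
    (h : PointsOutward C p (-ν)) : ¬ PointsOutward C p ν := by
  intro h'
  obtain ⟨t, h1, h2⟩ := (h.and h').exists
  refine h2.1 (interior_subset ?_)
  simpa using h1.2

/-- One-dimensional Gauss formula on a line parallel to the `i`-th axis that avoids the critical
values. -/
theorem integral_line_eq_sum {i : Fin (k + 1)} {y : Fin k → ℝ} (hy : y ∉ B.criticalValues i)
    (F : Fin B.numPieces → Finset (Fin k → ℝ))
    (hF : ∀ j u, u ∈ F j ↔ u ∈ B.regularPoints i j ∧ removeCoord i (B.piece j u) = y)
    {φ : (Fin (k + 1) → ℝ) → ℝ} (hφ : ContDiff ℝ 1 φ) :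
    ∫ t in {t : ℝ | i.insertNth (α := fun _ => ℝ) t y ∈ B.carrier},
        fderiv ℝ φ (i.insertNth (α := fun _ => ℝ) t y) (Pi.single i 1) =
      ∑ j, ∑ u ∈ F j,
        (SignType.sign (detCons (B.pieceVec j u) (Pi.single i 1)) : ℝ) * φ (B.piece j u) := by
  classical
  set L : ℝ → Fin (k + 1) → ℝ := fun t => i.insertNth (α := fun _ => ℝ) t y with hL
  set e : Fin (k + 1) → ℝ := Pi.single i 1 with he
  have hLadd : ∀ t τ, L (t + τ) = L t + τ • e := by
    intro t τ
    ext l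
    refine Fin.succAboveCases i ?_ (fun l => ?_) l <;> simp [hL, he]
  have hLi : ∀ t, L t i = t := fun t => by simp [hL]
  have hLproj : ∀ t, removeCoord i (L t) = y := fun t => by ext l; simp [hL]
  have hLinv : ∀ x, removeCoord i x = y → L (x i) = x := by
    rintro x rfl
    ext l
    refine Fin.succAboveCases i ?_ (fun l => ?_) l <;> simp [hL]
  have hLd : ∀ t, HasDerivAt L e t := by
    intro t
    have : L = fun τ => L 0 + τ • e := by
      ext1 τ
      rw [← hLadd, zero_add]
    rw [this]
    simpa using ((hasDerivAt_id t).smul_const e).const_add (L 0)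
  have hLc : Continuous L := continuous_iff_continuousAt.2 fun t => (hLd t).continuousAt
  set S : Set ℝ := {t | L t ∈ B.carrier} with hS
  have hSc : IsCompact S := by
    refine (B.isCompact_carrier.image (continuous_apply i)).of_isClosed_subset
      (B.isCompact_carrier.isClosed.preimage hLc) fun t ht => ⟨L t, ht, hLi t⟩
  set T : Finset ℝ := (Finset.univ.sigma F).image fun a => B.piece a.1 a.2 i with hT
  -- The sign is defined by the geometry because `T` consists of heights on the line, not of
  -- parameters `(j, u)`; `hsign` identifies it with the sign of the determinant.
  set s : ℝ → ℝ := fun t => if PointsOutward B.carrier (L t) e then 1 else -1 with hs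
  have hfib : ∀ j, ∀ u ∈ F j, L (B.piece j u i) = B.piece j u := fun j u hu =>
    hLinv _ ((hF j u).1 hu).2
  have hedge : ∀ j, ∀ u ∈ F j, B.piece j u ∉ B.edges := fun j u hu =>
    B.notMem_edges_of_notMem_criticalValues (i := i) (by rw [((hF j u).1 hu).2]; exact hy)
  have hfront : frontier S ⊆ T := by
    intro t ht
    have h1 : L t ∈ frontier B.carrier := hLc.frontier_preimage_subset B.carrier ht
    rw [B.frontier_eq] at h1
    obtain ⟨j, u, hu, hut⟩ := mem_iUnion.1 h1
    have h2 : removeCoord i (B.piece j u) = y := by rw [hut, hLproj]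
    have h3 : u ∈ F j := (hF j u).2
      ⟨B.mem_regularPoints_of_notMem_criticalValues hu (by rw [h2]; exact hy), h2⟩
    simp only [hT, Finset.coe_image, mem_image, Finset.mem_coe, Finset.mem_sigma, Finset.mem_univ,
      true_and]
    exact ⟨⟨j, u⟩, h3, by rw [hut, hLi]⟩
  have hright : ∀ t : ℝ, Filter.Tendsto (fun y => y - t) (𝓝[>] t) (𝓝[>] 0) := fun t => by
    refine tendsto_nhdsWithin_iff.2 ⟨?_, ?_⟩
    · refine Filter.Tendsto.mono_left ?_ nhdsWithin_le_nhds
      exact (continuous_sub_right t).tendsto' _ _ (sub_self t)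
    · filter_upwards [self_mem_nhdsWithin] with y hy using sub_pos.2 (mem_Ioi.1 hy)
  have hleft : ∀ t : ℝ, Filter.Tendsto (fun y => t - y) (𝓝[<] t) (𝓝[>] 0) := fun t => by
    refine tendsto_nhdsWithin_iff.2 ⟨?_, ?_⟩
    · refine Filter.Tendsto.mono_left ?_ nhdsWithin_le_nhds
      exact (continuous_sub_left t).tendsto' _ _ (sub_self t)
    · filter_upwards [self_mem_nhdsWithin] with y hy using sub_pos.2 (mem_Iio.1 hy)
  have hsign : ∀ j, ∀ u ∈ F j,
      (0 < detCons (B.pieceVec j u) e ∧ PointsOutward B.carrier (B.piece j u) e) ∨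
      (detCons (B.pieceVec j u) e < 0 ∧ PointsOutward B.carrier (B.piece j u) (-e)) := by
    intro j u hu
    have hreg := ((hF j u).1 hu).1
    have hne : detCons (B.pieceVec j u) e ≠ 0 := by
      rw [he, detCons_pieceVec_single]
      exact mul_ne_zero (pow_ne_zero _ (by norm_num)) hreg.2
    rcases lt_or_gt_of_ne hne with h | h
    · refine Or.inr ⟨h, B.pointsOutward_of_detCons_pos hreg.1 (hedge j u hu) ?_⟩
      rw [map_neg]
      linarith
    · exact Or.inl ⟨h, B.pointsOutward_of_detCons_pos hreg.1 (hedge j u hu) h⟩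
  have hside : ∀ t ∈ T,
      (s t = 1 ∧ (∀ᶠ y in 𝓝[>] t, y ∉ S) ∧ ∀ᶠ y in 𝓝[<] t, y ∈ S) ∨
      (s t = -1 ∧ (∀ᶠ y in 𝓝[<] t, y ∉ S) ∧ ∀ᶠ y in 𝓝[>] t, y ∈ S) := by
    intro t ht
    simp only [hT, Finset.mem_image, Finset.mem_sigma, Finset.mem_univ, true_and] at ht
    obtain ⟨⟨j, u⟩, hu, rfl⟩ := ht
    simp only at hu ⊢
    set t := B.piece j u i with htdef
    have hLt : L t = B.piece j u := hfib j u hu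
    rcases hsign j u hu with ⟨-, h⟩ | ⟨-, h⟩
    · refine Or.inl ⟨by simp only [hs, hLt, if_pos h], ?_, ?_⟩
      · filter_upwards [(hright t).eventually h] with y hy
        rw [hS, mem_ofPred_eq, show y = t + (y - t) by ring, hLadd, hLt]
        exact hy.1
      · filter_upwards [(hleft t).eventually h] with y hy
        rw [hS, mem_ofPred_eq, show y = t + -(t - y) by ring, hLadd, hLt, neg_smul,
          ← sub_eq_add_neg]
        exact interior_subset hy.2
    · refine Or.inr ⟨by simp only [hs, hLt, if_neg (not_pointsOutward_neg h)], ?_, ?_⟩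
      · filter_upwards [(hleft t).eventually h] with y hy
        rw [hS, mem_ofPred_eq, show y = t + -(t - y) by ring, hLadd, hLt, neg_smul,
          ← smul_neg]
        exact hy.1
      · filter_upwards [(hright t).eventually h] with y hy
        rw [hS, mem_ofPred_eq, show y = t + (y - t) by ring, hLadd, hLt]
        have := interior_subset hy.2
        rwa [smul_neg, sub_neg_eq_add] at this
  have hmain := setIntegral_eq_sum_of_one_sided hSc T s hfront hside
    (g := fun t => φ (L t)) (g' := fun t => fderiv ℝ φ (L t) e)
    (fun t => ((hφ.differentiable one_ne_zero) (L t)).hasFDerivAt.comp_hasDerivAt t (hLd t))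
    (((hφ.continuous_fderiv one_ne_zero).comp hLc).clm_apply continuous_const)
  rw [hmain, hT, Finset.sum_image, Finset.sum_sigma]
  · refine Finset.sum_congr rfl fun j _ => Finset.sum_congr rfl fun u hu => ?_
    simp only [hfib j u hu]
    congr 1
    rcases hsign j u hu with ⟨hd, h⟩ | ⟨hd, h⟩
    · simp only [hs, hfib j u hu, if_pos h, sign_pos hd, SignType.coe_one]
    · simp only [hs, hfib j u hu, if_neg (not_pointsOutward_neg h), sign_neg hd,
        SignType.coe_neg_one]
  -- No two parameters give the same height: on the line the height determines the point, and open
  -- pieces are injective and disjoint.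
  · rintro ⟨j, u⟩ hu ⟨j', u'⟩ hu' h
    simp only [Finset.coe_sigma, Finset.coe_univ, mem_sigma_iff, mem_univ, true_and,
      Finset.mem_coe] at hu hu' h
    have hpp : B.piece j u = B.piece j' u' := by
      rw [← hfib j u hu, ← hfib j' u' hu', h]
    have h1 := ((hF j u).1 hu).1.1
    have h2 := ((hF j' u').1 hu').1.1
    have hjj : j = j' := by
      by_contra hne
      exact disjoint_left.1 (B.disjoint_pieces j j' hne) ⟨u, h1, rfl⟩ ⟨u', h2, hpp.symm⟩
    subst hjj
    rw [B.injOn_piece j h1 h2 hpp]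

theorem continuousOn_detCons_pieceVec (j : Fin B.numPieces) (x : Fin (k + 1) → ℝ) :
    ContinuousOn (fun u => detCons (B.pieceVec j u) x) (unitCube k) := by
  simp only [detCons_apply]
  have hdet : Continuous fun M : Matrix (Fin (k + 1)) (Fin (k + 1)) ℝ => M.det :=
    continuous_id.matrix_det
  refine hdet.comp_continuousOn (continuousOn_pi.2 fun a => ?_)
  refine Fin.cases ?_ (fun a => ?_) a
  · exact continuousOn_const
  · exact B.continuousOn_pieceVec j a

/-- The Gauss formula for a disk with piecewise `C¹` boundary. -/
theorem integral_fderiv_single (i : Fin (k + 1)) {φ : (Fin (k + 1) → ℝ) → ℝ}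
    (hφ : ContDiff ℝ 1 φ) :
    ∫ x in B.carrier, fderiv ℝ φ x (Pi.single i 1) =
      ∑ j, ∫ u in unitCube k, φ (B.piece j u) * detCons (B.pieceVec j u) (Pi.single i 1) := by
  classical
  -- The factor between `detCons` and the Jacobian of the projection. It is put into the weight, so
  -- that the area formula produces exactly the boundary integrand.
  set σ : ℝ := (-1) ^ (i : ℕ) with hσ
  have hσ2 : σ = 1 ∨ σ = -1 := neg_one_pow_eq_or ℝ _
  have hinteg : ∀ j, IntegrableOn
      (fun u => (B.projDeriv i j u).det * (σ * φ (B.piece j u))) (unitCube k) := fun j =>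
    ((B.continuousOn_det_projDeriv i j).mul (continuousOn_const.mul
      (hφ.continuous.comp_continuousOn (B.continuousOn_piece j)))).integrableOn_compact
      isCompact_unitCube
  obtain ⟨G, hG1, hG2⟩ := exists_integral_eq_sum_integral_det (volume : Measure (Fin k → ℝ))
    (f := fun j u => removeCoord i (B.piece j u)) (f' := B.projDeriv i)
    (s := B.regularPoints i) (fun j => (B.isOpen_regularPoints i j).measurableSet)
    (fun j u hu => (B.hasFDerivWithinAt_proj i j (interior_subset hu.1)).mono
      fun v hv => interior_subset hv.1) (fun j u hu => hu.2)
    (fun j u => σ * φ (B.piece j u))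
    (fun j => (hinteg j).mono_set fun v hv => interior_subset hv.1)
  set g : (Fin (k + 1) → ℝ) → ℝ :=
    B.carrier.indicator fun x => fderiv ℝ φ x (Pi.single i 1) with hg
  have hgint : Integrable g := by
    rw [hg, integrable_indicator_iff B.isCompact_carrier.measurableSet]
    exact (((hφ.continuous_fderiv one_ne_zero).clm_apply
      continuous_const).continuousOn).integrableOn_compact B.isCompact_carrier
  have hmp := (volume_preserving_piFinSuccAbove (fun _ : Fin (k + 1) => ℝ) i).symm
  -- Fubini, with the integration along the `i`-th axis inside.
  have hlhs : ∫ x in B.carrier, fderiv ℝ φ x (Pi.single i 1) =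
      ∫ y : Fin k → ℝ, ∫ t : ℝ, g (i.insertNth (α := fun _ => ℝ) t y) := by
    rw [← integral_indicator B.isCompact_carrier.measurableSet, ← hg, ← hmp.integral_comp']
    rw [Measure.volume_eq_prod, integral_prod_symm]
    · rfl
    · rw [← Measure.volume_eq_prod]
      exact (hmp.integrable_comp_emb (MeasurableEquiv.measurableEmbedding _)).2 hgint
  have hae : (fun y : Fin k → ℝ => ∫ t : ℝ, g (i.insertNth (α := fun _ => ℝ) t y)) =ᵐ[volume]
      G := by
    have hnull : ∀ᵐ y : Fin k → ℝ, y ∉ B.criticalValues i :=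
      measure_eq_zero_iff_ae_notMem.1 (B.volume_criticalValues i)
    filter_upwards [hnull] with y hy
    set F : Fin B.numPieces → Finset (Fin k → ℝ) := fun j => (B.finite_fiber hy j).toFinset with hF
    have hFmem : ∀ j u, u ∈ F j ↔ u ∈ B.regularPoints i j ∧ removeCoord i (B.piece j u) = y :=
      fun j u => by simp [hF]
    rw [hG2 y F hFmem]
    have h1 := B.integral_line_eq_sum hy F hFmem hφ
    have hcont : Continuous fun t : ℝ => i.insertNth (α := fun _ => ℝ) t y :=
      Continuous.finInsertNth (A := fun _ => ℝ) i continuous_id continuous_const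
    have h2 : ∫ t : ℝ, g (i.insertNth (α := fun _ => ℝ) t y) =
        ∫ t in {t : ℝ | i.insertNth (α := fun _ => ℝ) t y ∈ B.carrier},
          fderiv ℝ φ (i.insertNth (α := fun _ => ℝ) t y) (Pi.single i 1) := by
      have hm : MeasurableSet {t : ℝ | i.insertNth (α := fun _ => ℝ) t y ∈ B.carrier} :=
        (B.isCompact_carrier.isClosed.preimage hcont).measurableSet
      rw [← integral_indicator hm]
      rfl
    rw [h2, h1]
    refine Finset.sum_congr rfl fun j _ => Finset.sum_congr rfl fun u _ => ?_
    rw [detCons_pieceVec_single, ← hσ, sign_mul, SignType.coe_mul]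
    rcases hσ2 with h | h <;> rw [h] <;> simp
  rw [hlhs, integral_congr_ae hae, hG1]
  refine Finset.sum_congr rfl fun j _ => ?_
  -- The area formula only sees regular points; the faces of the cube are null and at critical
  -- points the integrand vanishes.
  rw [← setIntegral_congr_set (interior_unitCube_ae_eq (k := k)),
    setIntegral_eq_of_subset_of_forall_sdiff_eq_zero (s := B.regularPoints i j)
      (t := interior (unitCube k)) isOpen_interior.measurableSet (fun u hu => hu.1)]
  · refine setIntegral_congr_fun (B.isOpen_regularPoints i j).measurableSet fun u _ => ?_
    rw [detCons_pieceVec_single, ← hσ]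
    ring
  · intro u hu
    rw [detCons_pieceVec_single]
    have : (B.projDeriv i j u).det = 0 := by
      by_contra h
      exact hu.2 ⟨hu.1, h⟩
    rw [this]
    simp

end DiskDomain

/-! ### Cross products of gradients -/

section DetCons

variable {k : ℕ}

theorem detCons_eq_dotProduct (w : Fin k → Fin (k + 1) → ℝ) (x : Fin (k + 1) → ℝ) :
    detCons w x = (fun i => detCons w (Pi.single i 1)) ⬝ᵥ x := by
  conv_lhs => rw [pi_eq_sum_univ' x]
  rw [map_sum]
  simp [dotProduct, mul_comm]

/-- The cross products of two `k`-tuples of vectors in `ℝ^(k+1)` have as inner product the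
determinant of the inner products. -/
theorem sum_detCons_mul_detCons (g w : Fin k → Fin (k + 1) → ℝ) :
    ∑ i, detCons g (Pi.single i 1) * detCons w (Pi.single i 1) =
      Matrix.det (Matrix.of fun a l => g l ⬝ᵥ w a) := by
  set c : Fin (k + 1) → ℝ := fun i => detCons w (Pi.single i 1) with hc
  have hlhs : ∑ i, detCons g (Pi.single i 1) * detCons w (Pi.single i 1) = detCons g c := by
    rw [detCons_eq_dotProduct g c]
    rfl
  rw [hlhs]
  by_cases hc0 : c = 0
  · rw [hc0, map_zero]
    -- Independent `w` would extend by some `x` to a basis, but `det (x, w)` is `c ⬝ᵥ x = 0`.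
    have hdep : ¬ LinearIndependent ℝ w := by
      intro hli
      obtain ⟨x, hx⟩ := exists_linearIndependent_cons_of_lt_finrank hli (by simp)
      have h1 : IsUnit (Matrix.of (Fin.cons x w : Fin (k + 1) → Fin (k + 1) → ℝ)) :=
        Matrix.linearIndependent_rows_iff_isUnit.1 hx
      have h2 := (Matrix.isUnit_iff_isUnit_det _).1 h1
      rw [← detCons_apply, detCons_eq_dotProduct, ← hc, hc0, zero_dotProduct] at h2
      exact not_isUnit_zero h2
    rw [Fintype.linearIndependent_iff] at hdep
    push Not at hdep
    obtain ⟨h, hh, i, hi⟩ := hdep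
    refine (Matrix.exists_vecMul_eq_zero_iff.1 ⟨h, fun h0 => hi (by rw [h0]; rfl), ?_⟩).symm
    ext l
    calc Matrix.vecMul h (Matrix.of fun a l => g l ⬝ᵥ w a) l = ∑ a, h a * (g l ⬝ᵥ w a) := rfl
      _ = g l ⬝ᵥ ∑ a, h a • w a := by
        rw [dotProduct_sum]
        simp
      _ = 0 := by rw [hh, dotProduct_zero]
  · have hcc : c ⬝ᵥ c ≠ 0 := fun h => hc0 (dotProduct_self_eq_zero.1 h)
    set A : Matrix (Fin (k + 1)) (Fin (k + 1)) ℝ := Matrix.of (Fin.cons c g) with hA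
    set W : Matrix (Fin (k + 1)) (Fin (k + 1)) ℝ := Matrix.of (Fin.cons c w) with hW
    have hW' : W.det = c ⬝ᵥ c := by
      rw [hW, ← detCons_apply, detCons_eq_dotProduct]
    have hcw : ∀ a, c ⬝ᵥ w a = 0 := fun a => by
      rw [hc, ← detCons_eq_dotProduct, detCons_self]
    -- Multiply `det (c, w)` by `det (c, g)`. As `c` is orthogonal to each `w a`, the first column
    -- of the product matrix is `(c ⬝ᵥ c, 0, …, 0)`, and the factor `c ⬝ᵥ c = det (c, w)` cancels.
    have hprod : (W * A.transpose).det =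
        c ⬝ᵥ c * Matrix.det (Matrix.of fun a l => g l ⬝ᵥ w a) := by
      rw [Matrix.det_succ_column_zero, Finset.sum_eq_single 0]
      · have h0 : (W * A.transpose) 0 0 = c ⬝ᵥ c := rfl
        have hs : (W * A.transpose).submatrix (Fin.succAbove 0) Fin.succ =
            Matrix.of fun a l => g l ⬝ᵥ w a := by
          ext a l
          simp only [Fin.succAbove_zero, Matrix.submatrix_apply, Matrix.of_apply]
          rw [dotProduct_comm]
          rfl
        rw [h0, hs]
        simp
      · intro a _ ha
        obtain ⟨a, rfl⟩ := Fin.exists_succ_eq.2 ha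
        have : (W * A.transpose) a.succ 0 = 0 := by
          rw [← hcw a, dotProduct_comm]
          rfl
        rw [this]
        simp
      · simp
    rw [Matrix.det_mul, Matrix.det_transpose, hW'] at hprod
    exact mul_left_cancel₀ hcc hprod

/-- Contracting a symmetric matrix with an alternating form gives zero. -/
theorem sum_detCons_update_eq_zero (w : Fin k → Fin (k + 1) → ℝ) (l : Fin k)
    (H : Matrix (Fin (k + 1)) (Fin (k + 1)) ℝ) (hH : ∀ a b, H a b = H b a) :
    ∑ i, detCons (Function.update w l (H i)) (Pi.single i 1) = 0 := by
  set A : (Fin (k + 1) → ℝ) → (Fin (k + 1) → ℝ) → ℝ :=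
    fun x y => detCons (Function.update w l y) x with hA
  have hA1 : ∀ x y z, A (x + y) z = A x z + A y z := fun x y z => map_add _ _ _
  have hAeq : ∀ x y, A x y = ((Matrix.detRowAlternating (R := ℝ)
      (n := Fin (k + 1))).curryLeft x) (Function.update w l y) := fun x y => rfl
  have hA2 : ∀ x y z, A x (y + z) = A x y + A x z := fun x y z => by
    simp only [hAeq, AlternatingMap.map_update_add]
  have hA3 : ∀ (c : ℝ) x y, A x (c • y) = c * A x y := fun c x y => by
    simp only [hAeq, AlternatingMap.map_update_smul, smul_eq_mul]
  have hA0 : ∀ x, A x x = 0 := fun x => by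
    have := detCons_self (Function.update w l x) l
    rwa [Function.update_self] at this
  have hanti : ∀ x y, A x y = -A y x := fun x y => by
    have := hA0 (x + y)
    rw [hA1, hA2, hA2, hA0, hA0] at this
    linarith
  have hsum : ∀ (x : Fin (k + 1) → ℝ) (s : Finset (Fin (k + 1))) (c : Fin (k + 1) → ℝ),
      A x (∑ b ∈ s, c b • Pi.single b 1) = ∑ b ∈ s, c b * A x (Pi.single b 1) := by
    intro x s c
    induction s using Finset.cons_induction with
    | empty =>
      simp only [Finset.sum_empty]
      have := hA3 0 x 0
      simpa using this
    | cons a s ha ih => rw [Finset.sum_cons, Finset.sum_cons, hA2, hA3, ih]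
  have hrow : ∀ i, A (Pi.single i 1) (H i) = ∑ b, H i b * A (Pi.single i 1) (Pi.single b 1) := by
    intro i
    conv_lhs => rw [pi_eq_sum_univ' (H i)]
    rw [hsum]
  -- Exchanging the two summation indices changes the sign of `A` and leaves `H` alone, so the sum
  -- is its own negative.
  have hS : ∑ i, A (Pi.single i 1) (H i) = -∑ i, A (Pi.single i 1) (H i) := by
    simp_rw [hrow]
    rw [← Finset.sum_neg_distrib]
    rw [Finset.sum_comm]
    refine Finset.sum_congr rfl fun i _ => ?_
    rw [← Finset.sum_neg_distrib]
    refine Finset.sum_congr rfl fun b _ => ?_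
    rw [hanti, hH]
    ring
  linarith

theorem continuous_detCons_left (x : Fin (k + 1) → ℝ) :
    Continuous fun w : Fin k → Fin (k + 1) → ℝ => detCons w x := by
  simp only [detCons_apply]
  refine Continuous.matrix_det (continuous_pi fun a => ?_)
  refine Fin.cases ?_ (fun a => ?_) a
  · exact continuous_const
  · exact continuous_apply a

/-- `w ↦ det (x, w₀, …, w_{k-1})` as a continuous multilinear map. -/
noncomputable def detConsMultilinear (x : Fin (k + 1) → ℝ) :
    ContinuousMultilinearMap ℝ (fun _ : Fin k => Fin (k + 1) → ℝ) ℝ where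
  toMultilinearMap :=
    ((Matrix.detRowAlternating (R := ℝ) (n := Fin (k + 1))).curryLeft x).toMultilinearMap
  cont := continuous_detCons_left x

end DetCons

section Gradient

variable {k : ℕ}

/-- The vector of partial derivatives. -/
noncomputable def gradVec {m : ℕ} (f : (Fin m → ℝ) → ℝ) (x : Fin m → ℝ) : Fin m → ℝ :=
  fun i => fderiv ℝ f x (Pi.single i 1)

theorem gradVec_dotProduct {m : ℕ} (f : (Fin m → ℝ) → ℝ) (x v : Fin m → ℝ) :
    gradVec f x ⬝ᵥ v = fderiv ℝ f x v := by
  conv_rhs => rw [pi_eq_sum_univ' v]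
  rw [map_sum]
  simp [dotProduct, gradVec, mul_comm]

theorem contDiff_gradVec {m : ℕ} {f : (Fin m → ℝ) → ℝ} (hf : ContDiff ℝ 2 f) :
    ContDiff ℝ 1 (gradVec f) :=
  contDiff_pi.2 fun _ => (hf.fderiv_right (m := 1) (by norm_num)).clm_apply contDiff_const

theorem fderiv_gradVec {m : ℕ} {f : (Fin m → ℝ) → ℝ} (hf : ContDiff ℝ 2 f) (x v : Fin m → ℝ)
    (i : Fin m) :
    fderiv ℝ (gradVec f) x v i = fderiv ℝ (fderiv ℝ f) x v (Pi.single i 1) := by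
  have h1 : DifferentiableAt ℝ (fderiv ℝ f) x :=
    (hf.fderiv_right (m := 1) (by norm_num)).differentiable one_ne_zero x
  have h2 : HasFDerivAt (gradVec f) (ContinuousLinearMap.pi fun i =>
      (fderiv ℝ (fderiv ℝ f) x).flip (Pi.single i 1)) x := by
    rw [hasFDerivAt_pi]
    intro i
    have := h1.hasFDerivAt.clm_apply (hasFDerivAt_const (Pi.single i (1 : ℝ) : Fin m → ℝ) x)
    simpa [gradVec] using this
  rw [h2.fderiv]
  rfl

/-- The cross product of gradients is divergence free. -/
theorem sum_fderiv_detCons_gradVec {g : Fin k → (Fin (k + 1) → ℝ) → ℝ}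
    (hg : ∀ l, ContDiff ℝ 2 (g l)) (x : Fin (k + 1) → ℝ) :
    ∑ i, fderiv ℝ (fun z => detCons (fun l => gradVec (g l) z) (Pi.single i 1)) x
      (Pi.single i 1) = 0 := by
  -- Differentiating the multilinear determinant replaces one gradient at a time by a row of its
  -- Hessian; for fixed `l` the sum over `i` is then the contraction of a symmetric matrix with an
  -- alternating form.
  have hd : ∀ i, fderiv ℝ (fun z => detCons (fun l => gradVec (g l) z) (Pi.single i 1)) x
      (Pi.single i 1) = ∑ l, detCons (Function.update (fun l => gradVec (g l) x) l
        (fderiv ℝ (gradVec (g l)) x (Pi.single i 1))) (Pi.single i 1) := by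
    intro i
    have h1 : HasFDerivAt (fun z l => gradVec (g l) z)
        (ContinuousLinearMap.pi fun l => fderiv ℝ (gradVec (g l)) x) x :=
      hasFDerivAt_pi.2 fun l => ((contDiff_gradVec (hg l)).differentiable one_ne_zero x).hasFDerivAt
    have h2 := ((detConsMultilinear (Pi.single i 1)).hasFDerivAt
      (fun l => gradVec (g l) x)).comp x h1
    have h3 : HasFDerivAt (fun z => detCons (fun l => gradVec (g l) z) (Pi.single i 1)) _ x := h2
    rw [h3.fderiv]
    simp only [ContinuousLinearMap.comp_apply, ContinuousMultilinearMap.linearDeriv_apply]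
    rfl
  simp_rw [hd]
  rw [Finset.sum_comm]
  refine Finset.sum_eq_zero fun l _ => ?_
  refine sum_detCons_update_eq_zero (fun l => gradVec (g l) x) l
    (Matrix.of fun i => fderiv ℝ (gradVec (g l)) x (Pi.single i 1)) fun a b => ?_
  simp only [Matrix.of_apply]
  rw [fderiv_gradVec (hg l), fderiv_gradVec (hg l)]
  exact ((hg l).contDiffAt.isSymmSndFDerivAt (by simp)).eq _ _

end Gradient

/-! ### Stokes' formula in Euclidean space -/

namespace DiskDomain

variable {k : ℕ} (B : DiskDomain k)

/-- Stokes' formula for `b dg₁ ∧ … ∧ dg_k` when `b` is `C¹` and the `g_l` are `C²`. -/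
theorem stokes_of_contDiff_two {b : (Fin (k + 1) → ℝ) → ℝ} {g : Fin k → (Fin (k + 1) → ℝ) → ℝ}
    (hb : ContDiff ℝ 1 b) (hg : ∀ l, ContDiff ℝ 2 (g l)) :
    ∫ x in B.carrier, detCons (fun l => gradVec (g l) x) (gradVec b x) =
      ∑ j, ∫ u in unitCube k, b (B.piece j u) *
        Matrix.det (Matrix.of fun i l => fderiv ℝ (g l) (B.piece j u) (B.pieceVec j u i)) := by
  set X : Fin (k + 1) → (Fin (k + 1) → ℝ) → ℝ :=
    fun i x => detCons (fun l => gradVec (g l) x) (Pi.single i 1) with hX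
  have hXc : ∀ i, ContDiff ℝ 1 (X i) := fun i => by
    have h1 : ContDiff ℝ 1 fun x l => gradVec (g l) x :=
      contDiff_pi.2 fun l => contDiff_gradVec (hg l)
    exact (detConsMultilinear (Pi.single i 1)).contDiff.comp h1
  have hbX : ∀ i, ContDiff ℝ 1 fun x => b x * X i x := fun i => hb.mul (hXc i)
  -- The divergence of `b X` is `∇b · X`, because `X` is divergence free.
  have hpt : ∀ x, detCons (fun l => gradVec (g l) x) (gradVec b x) =
      ∑ i, fderiv ℝ (fun x => b x * X i x) x (Pi.single i 1) := by
    intro x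
    have h1 : ∀ i, fderiv ℝ (fun x => b x * X i x) x (Pi.single i 1) =
        b x * fderiv ℝ (X i) x (Pi.single i 1) + X i x * gradVec b x i := fun i => by
      rw [fderiv_fun_mul (hb.differentiable one_ne_zero x) ((hXc i).differentiable one_ne_zero x)]
      simp [gradVec]
    simp_rw [h1]
    rw [Finset.sum_add_distrib, ← Finset.mul_sum, sum_fderiv_detCons_gradVec hg, mul_zero,
      zero_add, detCons_eq_dotProduct]
    rfl
  have hL : ∀ i, IntegrableOn (fun x => fderiv ℝ (fun x => b x * X i x) x (Pi.single i 1))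
      B.carrier := fun i =>
    ((((hbX i).continuous_fderiv one_ne_zero).clm_apply
      continuous_const).continuousOn).integrableOn_compact B.isCompact_carrier
  have hR : ∀ j i, IntegrableOn (fun u => (b (B.piece j u) * X i (B.piece j u)) *
      detCons (B.pieceVec j u) (Pi.single i 1)) (unitCube k) := fun j i =>
    (((hbX i).continuous.comp_continuousOn (B.continuousOn_piece j)).mul
      (B.continuousOn_detCons_pieceVec j _)).integrableOn_compact isCompact_unitCube
  simp_rw [hpt]
  rw [integral_finsetSum _ fun i _ => hL i]
  simp_rw [fun i => B.integral_fderiv_single i (hbX i)]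
  rw [Finset.sum_comm]
  refine Finset.sum_congr rfl fun j _ => ?_
  rw [← integral_finsetSum _ fun i _ => hR j i]
  refine integral_congr_ae (Filter.Eventually.of_forall fun u => ?_)
  simp only [mul_assoc]
  rw [← Finset.mul_sum, hX, sum_detCons_mul_detCons]
  simp_rw [gradVec_dotProduct]

end DiskDomain

section Approximation

variable {E : Type*} [NormedAddCommGroup E] [NormedSpace ℝ E] [FiniteDimensional ℝ E]

/-- A function that is `C¹` at the points of a compact set agrees near it with a compactly
supported `C¹` function. -/
theorem exists_contDiff_one_eventuallyEq {f : E → ℝ} {K : Set E} (hK : IsCompact K)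
    (hf : ∀ x ∈ K, ContDiffAt ℝ 1 f x) :
    ∃ g : E → ℝ, ContDiff ℝ 1 g ∧ HasCompactSupport g ∧ ∀ x ∈ K, g =ᶠ[𝓝 x] f := by
  set U : Set E := {x | ContDiffAt ℝ 1 f x} with hU
  have hUo : IsOpen U := by
    rw [isOpen_iff_eventually]
    intro x hx
    exact (show ContDiffAt ℝ 1 f x from hx).eventually (by simp)
  obtain ⟨t, ht, hKt, htU⟩ := exists_compact_between hK hUo hf
  obtain ⟨χ, hχ1, hχ0, -⟩ := exists_contMDiffMap_one_nhds_of_subset_interior (n := ⊤) 𝓘(ℝ, E)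
    hK.isClosed hKt
  have hχ : ContDiff ℝ 1 χ := χ.contMDiff.contDiff.of_le (by simp)
  refine ⟨fun x => χ x * f x, contDiff_iff_contDiffAt.2 fun x => ?_, ?_, fun x hx => ?_⟩
  · by_cases hx : x ∈ t
    · exact hχ.contDiffAt.mul (htU hx)
    · refine (contDiffAt_const (c := (0 : ℝ))).congr_of_eventuallyEq ?_
      filter_upwards [ht.isClosed.isOpen_compl.mem_nhds hx] with y hy
      rw [hχ0 y hy, zero_mul]
  · exact HasCompactSupport.intro ht fun x hx => by rw [hχ0 x hx, zero_mul]
  · filter_upwards [hχ1.filter_mono (nhds_le_nhdsSet hx)] with y hy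
    rw [hy, one_mul]

/-- Smooth approximation in `C¹`. -/
theorem exists_contDiff_dist_fderiv_le {f : E → ℝ} (hf : ContDiff ℝ 1 f)
    (hc : HasCompactSupport f) {ε : ℝ} (hε : 0 < ε) :
    ∃ g : E → ℝ, ContDiff ℝ ∞ g ∧ ∀ x, ‖fderiv ℝ g x - fderiv ℝ f x‖ ≤ ε := by
  borelize E
  have huc : UniformContinuous (fderiv ℝ f) :=
    (hc.fderiv ℝ).uniformContinuous_of_continuous (hf.continuous_fderiv one_ne_zero)
  obtain ⟨δ, hδ, hδf⟩ := Metric.uniformContinuous_iff.1 huc ε hε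
  set φ : ContDiffBump (0 : E) := ⟨δ / 2, δ, half_pos hδ, half_lt_self hδ⟩ with hφ
  set μ : Measure E := Measure.addHaar
  have hd : ∀ x, fderiv ℝ (convolution (φ.normed μ) f (ContinuousLinearMap.lsmul ℝ ℝ) μ) x =
      convolution (φ.normed μ) (fderiv ℝ f) (ContinuousLinearMap.lsmul ℝ ℝ) μ x := by
    intro x
    rw [(hc.hasFDerivAt_convolution_right (ContinuousLinearMap.lsmul ℝ ℝ)
      (φ.contDiff_normed (n := 0)).continuous.locallyIntegrable hf x).fderiv]
    rfl
  refine ⟨convolution (φ.normed μ) f (ContinuousLinearMap.lsmul ℝ ℝ) μ, ?_, fun x => ?_⟩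
  · exact φ.hasCompactSupport_normed.contDiff_convolution_left _ φ.contDiff_normed
      hf.continuous.locallyIntegrable
  · rw [hd, ← dist_eq_norm]
    exact φ.dist_normed_convolution_le (hf.continuous_fderiv one_ne_zero).aestronglyMeasurable
      fun y hy => (hδf hy).le

end Approximation

theorem abs_det_le_of_forall_abs_le {m : ℕ} {A : Matrix (Fin m) (Fin m) ℝ} {c : ℝ}
    (h : ∀ i j, |A i j| ≤ c) : |A.det| ≤ (m.factorial : ℝ) * c ^ m := by
  have := Matrix.det_le (abv := AbsoluteValue.abs) (A := A) (x := c) h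
  simpa using this

namespace DiskDomain

variable {k : ℕ} (B : DiskDomain k)

/-- Stokes' formula for `b dg₁ ∧ … ∧ dg_k` with `C¹` functions `b`, `g_l`. -/
theorem stokes {b : (Fin (k + 1) → ℝ) → ℝ} {g : Fin k → (Fin (k + 1) → ℝ) → ℝ}
    (hb : ∀ x ∈ B.carrier, ContDiffAt ℝ 1 b x) (hg : ∀ l, ∀ x ∈ B.carrier, ContDiffAt ℝ 1 (g l) x) :
    ∫ x in B.carrier, detCons (fun l => gradVec (g l) x) (gradVec b x) =
      ∑ j, ∫ u in unitCube k, b (B.piece j u) *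
        Matrix.det (Matrix.of fun i l => fderiv ℝ (g l) (B.piece j u) (B.pieceVec j u i)) := by
  -- reduce to compactly supported functions
  wlog hglob : ContDiff ℝ 1 b ∧ ∀ l, ContDiff ℝ 1 (g l) ∧ HasCompactSupport (g l) generalizing b g
  · obtain ⟨b', hb'1, -, hb'⟩ := exists_contDiff_one_eventuallyEq B.isCompact_carrier hb
    choose g' hg'1 hg'2 hg' using fun l =>
      exists_contDiff_one_eventuallyEq B.isCompact_carrier (hg l)
    have h := this (b := b') (g := g') (fun x _ => hb'1.contDiffAt)
      (fun l x _ => (hg'1 l).contDiffAt) ⟨hb'1, fun l => ⟨hg'1 l, hg'2 l⟩⟩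
    have hfd : ∀ l, ∀ x ∈ B.carrier, fderiv ℝ (g' l) x = fderiv ℝ (g l) x := fun l x hx =>
      (hg' l x hx).fderiv_eq
    have hfb : ∀ x ∈ B.carrier, fderiv ℝ b' x = fderiv ℝ b x := fun x hx => (hb' x hx).fderiv_eq
    convert h using 1
    · refine setIntegral_congr_fun B.isCompact_carrier.measurableSet fun x hx => ?_
      have h1 : ∀ l, gradVec (g' l) x = gradVec (g l) x := fun l => by
        funext i
        rw [gradVec, gradVec, hfd l x hx]
      have h2 : gradVec b' x = gradVec b x := by
        funext i
        rw [gradVec, gradVec, hfb x hx]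
      simp only [h1, h2]
    · refine Finset.sum_congr rfl fun j _ => ?_
      refine setIntegral_congr_fun isCompact_unitCube.measurableSet fun u hu => ?_
      have hm := B.piece_mem_carrier j hu
      simp only [hfd _ _ hm, (hb' _ hm).eq_of_nhds]
  obtain ⟨hb1, hg1⟩ := hglob
  -- The `g_l` enter both sides through their first derivatives only, so uniform convergence of
  -- these is enough; `b` needs no smoothing. Both sides pass to the limit by bounded convergence.
  choose G hG1 hG2 using fun (n : ℕ) (l : Fin k) =>
    exists_contDiff_dist_fderiv_le (hg1 l).1 (hg1 l).2 (ε := 1 / ((n : ℝ) + 1)) (by positivity)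
  have hst : ∀ n, ∫ x in B.carrier, detCons (fun l => gradVec (G n l) x) (gradVec b x) =
      ∑ j, ∫ u in unitCube k, b (B.piece j u) *
        Matrix.det (Matrix.of fun i l => fderiv ℝ (G n l) (B.piece j u) (B.pieceVec j u i)) :=
    fun n => B.stokes_of_contDiff_two hb1 fun l => (hG1 n l).of_le ENat.LEInfty.out
  have hlim : ∀ l x, Filter.Tendsto (fun n => fderiv ℝ (G n l) x) Filter.atTop
      (𝓝 (fderiv ℝ (g l) x)) := fun l x => by
    rw [tendsto_iff_norm_sub_tendsto_zero]
    exact squeeze_zero (fun n => norm_nonneg _) (fun n => hG2 n l x)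
      tendsto_one_div_add_atTop_nhds_zero_nat
  have hbd : ∃ C : ℝ, 0 ≤ C ∧ ∀ n l x, ‖fderiv ℝ (G n l) x‖ ≤ C := by
    have h1 : ∀ l, ∃ C : ℝ, ∀ x, ‖fderiv ℝ (g l) x‖ ≤ C := fun l =>
      ((hg1 l).2.fderiv ℝ).exists_bound_of_continuous ((hg1 l).1.continuous_fderiv one_ne_zero)
    choose C hC using h1
    have hCnn : ∀ l, 0 ≤ C l := fun l => (norm_nonneg _).trans (hC l 0)
    refine ⟨∑ l, C l + 1, by have := Finset.sum_nonneg fun l (_ : l ∈ Finset.univ) => hCnn l;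
                             linarith, fun n l x => ?_⟩
    have h2 : ‖fderiv ℝ (G n l) x‖ ≤ ‖fderiv ℝ (g l) x‖ + 1 / ((n : ℝ) + 1) := by
      have := norm_le_norm_add_norm_sub (fderiv ℝ (g l) x) (fderiv ℝ (G n l) x)
      have h3 := hG2 n l x
      rw [norm_sub_rev] at h3
      linarith
    have h3 : 1 / ((n : ℝ) + 1) ≤ 1 := by
      rw [div_le_one (by positivity)]
      linarith [Nat.cast_nonneg (α := ℝ) n]
    have h4 : C l ≤ ∑ l, C l :=
      Finset.single_le_sum (f := C) (fun l _ => hCnn l) (Finset.mem_univ l)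
    linarith [hC l x]
  obtain ⟨C, hC0, hC⟩ := hbd
  have hgv : ∀ n l, Continuous (gradVec (G n l)) := fun n l =>
    (contDiff_gradVec ((hG1 n l).of_le ENat.LEInfty.out)).continuous
  have hbc : Continuous (gradVec b) :=
    continuous_pi fun i => (hb1.continuous_fderiv one_ne_zero).clm_apply continuous_const
  have hsingle : ∀ i : Fin (k + 1), ‖(Pi.single i 1 : Fin (k + 1) → ℝ)‖ ≤ 1 := fun i => by
    rw [Pi.norm_single, norm_one]
  have hleft : Filter.Tendsto
      (fun n => ∫ x in B.carrier, detCons (fun l => gradVec (G n l) x) (gradVec b x)) Filter.atTop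
      (𝓝 (∫ x in B.carrier, detCons (fun l => gradVec (g l) x) (gradVec b x))) := by
    have : IsFiniteMeasure (volume.restrict B.carrier) :=
      ⟨by simpa using B.isCompact_carrier.measure_lt_top⟩
    obtain ⟨b₀, hb₀⟩ := B.isCompact_carrier.exists_bound_of_continuousOn hbc.continuousOn
    refine tendsto_integral_filter_of_norm_le_const (Filter.Eventually.of_forall fun n => ?_)
      ⟨((k + 1).factorial : ℝ) * (max C b₀) ^ (k + 1), Filter.Eventually.of_forall fun n => ?_⟩
      (Filter.Eventually.of_forall fun x => ?_)
    · refine Continuous.aestronglyMeasurable ?_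
      simp only [detCons_apply]
      refine Continuous.matrix_det (continuous_pi fun a => ?_)
      refine Fin.cases hbc (fun a => hgv n a) a
    · filter_upwards [ae_restrict_mem B.isCompact_carrier.measurableSet] with x hx
      rw [detCons_apply]
      refine abs_det_le_of_forall_abs_le fun a m => ?_
      refine Fin.cases ?_ (fun a => ?_) a
      · exact ((norm_le_pi_norm (gradVec b x) m).trans (hb₀ x hx)).trans (le_max_right _ _)
      · refine le_trans ?_ (le_max_left _ _)
        exact ((fderiv ℝ (G n a) x).le_opNorm _).trans
          ((mul_le_mul (hC n a x) (hsingle m) (norm_nonneg _) hC0).trans (mul_one C).le)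
    · refine ((continuous_detCons_left (gradVec b x)).tendsto _).comp ?_
      refine tendsto_pi_nhds.2 fun l => tendsto_pi_nhds.2 fun m => ?_
      exact ((ContinuousLinearMap.apply ℝ ℝ (Pi.single m 1)).continuous.tendsto _).comp (hlim l x)
  have hright : Filter.Tendsto (fun n => ∑ j, ∫ u in unitCube k, b (B.piece j u) *
        Matrix.det (Matrix.of fun i l => fderiv ℝ (G n l) (B.piece j u) (B.pieceVec j u i)))
      Filter.atTop (𝓝 (∑ j, ∫ u in unitCube k, b (B.piece j u) *
        Matrix.det (Matrix.of fun i l => fderiv ℝ (g l) (B.piece j u) (B.pieceVec j u i)))) := by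
    refine tendsto_finsetSum _ fun j _ => ?_
    have : IsFiniteMeasure (volume.restrict (unitCube k)) :=
      ⟨by simpa using isCompact_unitCube.measure_lt_top⟩
    obtain ⟨b₀, hb₀⟩ := isCompact_unitCube.exists_bound_of_continuousOn
      (hb1.continuous.comp_continuousOn (B.continuousOn_piece j))
    obtain ⟨w₀, hw₀⟩ := isCompact_unitCube.exists_bound_of_continuousOn
      (continuousOn_pi.2 (B.continuousOn_pieceVec j))
    refine tendsto_integral_filter_of_norm_le_const (Filter.Eventually.of_forall fun n => ?_)
      ⟨b₀ * ((k.factorial : ℝ) * (C * w₀) ^ k), Filter.Eventually.of_forall fun n => ?_⟩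
      (Filter.Eventually.of_forall fun u => ?_)
    · refine ContinuousOn.aestronglyMeasurable ?_ isCompact_unitCube.measurableSet
      refine (hb1.continuous.comp_continuousOn (B.continuousOn_piece j)).mul ?_
      have hdet : Continuous fun M : Matrix (Fin k) (Fin k) ℝ => M.det :=
        continuous_id.matrix_det
      refine hdet.comp_continuousOn (continuousOn_pi.2 fun i => continuousOn_pi.2 fun l => ?_)
      exact (((hG1 n l).continuous_fderiv (by simp)).comp_continuousOn
        (B.continuousOn_piece j)).clm_apply (B.continuousOn_pieceVec j i)
    · filter_upwards [ae_restrict_mem isCompact_unitCube.measurableSet] with u hu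
      rw [norm_mul]
      refine mul_le_mul (hb₀ u hu) ?_ (norm_nonneg _) ((norm_nonneg _).trans (hb₀ u hu))
      refine abs_det_le_of_forall_abs_le fun i l => ?_
      refine ((fderiv ℝ (G n l) (B.piece j u)).le_opNorm _).trans ?_
      exact mul_le_mul (hC n l _) ((norm_le_pi_norm (B.pieceVec j u) i).trans (hw₀ u hu))
        (norm_nonneg _) hC0
    · refine Filter.Tendsto.const_mul _ ?_
      have hdet : Continuous fun M : Matrix (Fin k) (Fin k) ℝ => M.det :=
        continuous_id.matrix_det
      refine (hdet.tendsto _).comp ?_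
      refine tendsto_pi_nhds.2 fun i => tendsto_pi_nhds.2 fun l => ?_
      exact ((ContinuousLinearMap.apply ℝ ℝ (B.pieceVec j u i)).continuous.tendsto _).comp
        (hlim l _)
  simp_rw [hst] at hleft
  exact tendsto_nhds_unique hleft hright

end DiskDomain

/-! ### Regularization of Hölder functions -/

section Approximation

variable {E : Type*} [NormedAddCommGroup E] [NormedSpace ℝ E] [FiniteDimensional ℝ E]

/-- Mollification keeps the bound and the Lipschitz constant of a function. -/
theorem exists_contDiff_approx_of_lipschitz {h : E → ℝ} {L : ℝ≥0} (hL : LipschitzWith L h) {H : ℝ}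
    (hH : ∀ x, |h x| ≤ H) {ε : ℝ} (hε : 0 < ε) :
    ∃ g : E → ℝ, ContDiff ℝ ∞ g ∧ (∀ x, |g x| ≤ H) ∧ (∀ x, |g x - h x| ≤ L * ε) ∧
      LipschitzWith L g := by
  borelize E
  set φ : ContDiffBump (0 : E) := ⟨ε / 2, ε, half_pos hε, half_lt_self hε⟩ with hφ
  set μ : Measure E := Measure.addHaar
  set g : E → ℝ := convolution (φ.normed μ) h (ContinuousLinearMap.lsmul ℝ ℝ) μ with hg
  have hgdef : ∀ x, g x = ∫ t, φ.normed μ t * h (x - t) ∂μ := fun x => rfl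
  have hφc : Continuous (φ.normed μ) := (φ.contDiff_normed (n := 0)).continuous
  have hinteg : ∀ x, Integrable (fun t => φ.normed μ t * h (x - t)) μ := fun x =>
    (hφc.mul (hL.continuous.comp (continuous_sub_left x))).integrable_of_hasCompactSupport
      φ.hasCompactSupport_normed.mul_right
  have hφi : Integrable (φ.normed μ) μ :=
    hφc.integrable_of_hasCompactSupport φ.hasCompactSupport_normed
  have hbound : ∀ (q : E → ℝ) (c : ℝ), (∀ t, |q t| ≤ c) →
      |∫ t, φ.normed μ t * q t ∂μ| ≤ c := by
    intro q c hq
    calc |∫ t, φ.normed μ t * q t ∂μ| ≤ ∫ t, φ.normed μ t * c ∂μ := by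
          rw [← Real.norm_eq_abs]
          refine norm_integral_le_of_norm_le (hφi.mul_const c) (Filter.Eventually.of_forall ?_)
          intro t
          rw [norm_mul, Real.norm_of_nonneg (φ.nonneg_normed t)]
          exact mul_le_mul_of_nonneg_left (hq t) (φ.nonneg_normed t)
      _ = c := by rw [integral_mul_const, φ.integral_normed, one_mul]
  refine ⟨g, ?_, fun x => ?_, fun x => ?_, ?_⟩
  · exact φ.hasCompactSupport_normed.contDiff_convolution_left _ φ.contDiff_normed
      hL.continuous.locallyIntegrable
  · rw [hgdef]
    exact hbound (fun t => h (x - t)) H fun t => hH _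
  · rw [← Real.dist_eq]
    refine φ.dist_normed_convolution_le hL.continuous.aestronglyMeasurable fun y hy => ?_
    refine (hL.dist_le_mul y x).trans ?_
    gcongr
    exact (Metric.mem_ball.1 hy).le
  · refine LipschitzWith.of_dist_le_mul fun x y => ?_
    rw [Real.dist_eq, hgdef, hgdef, ← integral_sub (hinteg x) (hinteg y)]
    simp_rw [← mul_sub]
    refine hbound _ _ fun t => ?_
    have := hL.dist_le_mul (x - t) (y - t)
    rwa [Real.dist_eq, dist_sub_right] at this

/-- Regularization of a Hölder function on a subset: the error is of order `ε ^ θ` and the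
derivative is of order `ε ^ (θ - 1)`. -/
theorem exists_contDiff_approx_of_holder {s : Set E} {f : E → ℝ} {H ε θ : ℝ} (hε : 0 < ε)
    (hH : 0 ≤ H) (hθ₀ : 0 ≤ θ) (hθ₁ : θ ≤ 1) (hb : ∀ x ∈ s, |f x| ≤ H)
    (hh : ∀ x ∈ s, ∀ y ∈ s, |f x - f y| ≤ H * dist x y ^ θ) :
    ∃ g : E → ℝ, ContDiff ℝ ∞ g ∧ (∀ x, |g x| ≤ H) ∧ (∀ x ∈ s, |g x - f x| ≤ 2 * H * ε ^ θ) ∧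
      ∀ x, ‖fderiv ℝ g x‖ ≤ H * ε ^ (θ - 1) := by
  -- The infimum below is meaningless for empty `s`.
  rcases s.eq_empty_or_nonempty with rfl | hne
  · refine ⟨fun _ => 0, contDiff_const, by simpa using hH, by simp, fun x => ?_⟩
    simp only [fderiv_fun_const, Pi.zero_apply, norm_zero]
    positivity
  have : Nonempty s := hne.to_subtype
  -- The slope for which `L * ε = H * ε ^ θ`: the Lipschitz and Hölder moduli agree at distance `ε`.
  -- The function `h` is the infimal convolution of `f` with the cone of slope `L`.
  set L : ℝ := H * ε ^ (θ - 1) with hLdef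
  have hL0 : 0 ≤ L := by positivity
  set h : E → ℝ := fun x => ⨅ y : s, (f y + L * dist x y) with hh'
  have hlow : ∀ (x : E) (y : s), -H ≤ f y + L * dist x (y : E) := fun x y => by
    have := (abs_le.1 (hb y y.2)).1
    have : 0 ≤ L * dist x (y : E) := by positivity
    linarith
  have hbdd : ∀ x : E, BddBelow (range fun y : s => f y + L * dist x (y : E)) := fun x =>
    ⟨-H, by rintro _ ⟨y, rfl⟩; exact hlow x y⟩
  have hlip : LipschitzWith L.toNNReal h := by
    refine LipschitzWith.of_le_add_mul' L fun x z => ?_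
    rw [← sub_le_iff_le_add]
    refine le_ciInf fun y => ?_
    rw [sub_le_iff_le_add]
    refine (ciInf_le (hbdd x) y).trans ?_
    have h1 := mul_le_mul_of_nonneg_left (dist_triangle x z (y : E)) hL0
    linarith
  have hle : ∀ x ∈ s, h x ≤ f x := fun x hx => by
    refine (ciInf_le (hbdd x) ⟨x, hx⟩).trans ?_
    simp
  have hge : ∀ x ∈ s, f x - H * ε ^ θ ≤ h x := fun x hx => by
    refine le_ciInf fun y => ?_
    have h1 := (abs_le.1 (hh x hx y y.2)).2
    have h2 : dist x (y : E) ^ θ ≤ ε ^ θ + ε ^ (θ - 1) * dist x (y : E) := by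
      -- Below distance `ε` the constant dominates; beyond it the linear term does, since `θ - 1 ≤
      -- 0`.
      rcases le_total (dist x (y : E)) ε with hd | hd
      · have h3 : dist x (y : E) ^ θ ≤ ε ^ θ := Real.rpow_le_rpow dist_nonneg hd hθ₀
        have h4 : 0 ≤ ε ^ (θ - 1) * dist x (y : E) := by positivity
        linarith
      · have hd0 : 0 < dist x (y : E) := hε.trans_le hd
        have h3 : dist x (y : E) ^ θ = dist x (y : E) ^ (θ - 1) * dist x (y : E) := by
          rw [Real.rpow_sub_one hd0.ne']
          field_simp
        have h4 : dist x (y : E) ^ (θ - 1) ≤ ε ^ (θ - 1) :=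
          Real.rpow_le_rpow_of_nonpos hε hd (by linarith)
        have h5 := mul_le_mul_of_nonneg_right h4 hd0.le
        have h6 : 0 ≤ ε ^ θ := by positivity
        linarith
    have h3 := mul_le_mul_of_nonneg_left h2 hH
    have h4 : L * dist x (y : E) = H * (ε ^ (θ - 1) * dist x (y : E)) := by
      rw [hLdef]; ring
    rw [h4]
    linarith
  -- Far from `s` the envelope grows. Truncation restores the sup bound and changes nothing on `s`,
  -- where `h ≤ f ≤ H`.
  set h₁ : E → ℝ := fun x => min (h x) H with hh₁
  have hlip₁ : LipschitzWith L.toNNReal h₁ := hlip.min_const H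
  have hb₁ : ∀ x, |h₁ x| ≤ H := fun x => by
    rw [abs_le]
    refine ⟨le_min (le_ciInf fun y => hlow x y) (by linarith), min_le_right _ _⟩
  obtain ⟨g, hg1, hg2, hg3, hg4⟩ := exists_contDiff_approx_of_lipschitz hlip₁ hb₁ hε
  refine ⟨g, hg1, hg2, fun x hx => ?_, fun x => ?_⟩
  · have h1 : h₁ x = h x := min_eq_left ((hle x hx).trans (abs_le.1 (hb x hx)).2)
    have h2 := abs_le.1 (hg3 x)
    rw [h1, Real.coe_toNNReal L hL0] at h2
    -- The factor 2 in the error: one `H * ε ^ θ` from the envelope, one from mollifying at scale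
    -- `ε`.
    have h3 : L * ε = H * ε ^ θ := by
      rw [hLdef, Real.rpow_sub_one hε.ne']
      field_simp
    rw [h3] at h2
    have h4 := hle x hx
    have h5 := hge x hx
    have h6 : 0 ≤ H * ε ^ θ := by positivity
    rw [abs_le]
    constructor <;> linarith [h2.1, h2.2]
  · have := norm_fderiv_le_of_lipschitz ℝ hg4 (x₀ := x)
    rwa [Real.coe_toNNReal L hL0] at this

end Approximation

/-! ### Determinants against Riemannian volume -/

section Gram

/-- Bounds are taken column by column because in the interior estimate the column of `db` has a
constant of its own, of order `ε ^ (θ - 1)`. -/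
theorem abs_det_le_factorial_mul_prod {m : ℕ} {A : Matrix (Fin m) (Fin m) ℝ} {c : Fin m → ℝ}
    (h : ∀ i j, |A i j| ≤ c j) : |A.det| ≤ m.factorial * ∏ j, c j := by
  rw [Matrix.det_apply]
  calc |∑ σ : Equiv.Perm (Fin m), Equiv.Perm.sign σ • ∏ i, A (σ i) i|
      ≤ ∑ σ : Equiv.Perm (Fin m), |Equiv.Perm.sign σ • ∏ i, A (σ i) i| :=
        Finset.abs_sum_le_sum_abs _ _
    _ ≤ ∑ _σ : Equiv.Perm (Fin m), ∏ j, c j := by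
        refine Finset.sum_le_sum fun σ _ => ?_
        have h1 : |Equiv.Perm.sign σ • ∏ i, A (σ i) i| = ∏ i, |A (σ i) i| := by
          rw [← Finset.abs_prod]
          rcases Int.units_eq_one_or (Equiv.Perm.sign σ) with h | h <;> simp [h]
        rw [h1]
        exact Finset.prod_le_prod (fun i _ => abs_nonneg _) fun i _ => h _ _
    _ = m.factorial * ∏ j, c j := by
        rw [Finset.sum_const, Finset.card_univ, Fintype.card_perm, Fintype.card_fin, nsmul_eq_mul]

/-- A determinant of bounded linear forms is controlled by the volume of the parallelepiped. -/
theorem abs_det_le_sqrt_det_gram {V : Type*} [NormedAddCommGroup V] [InnerProductSpace ℝ V]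
    {m : ℕ} (ℓ : Fin m → V →ₗ[ℝ] ℝ) (v : Fin m → V) {c : Fin m → ℝ}
    (hc : ∀ l v, |ℓ l v| ≤ c l * ‖v‖) :
    |Matrix.det (Matrix.of fun i l => ℓ l (v i))| ≤
      m.factorial * (∏ l, c l) * Real.sqrt (Matrix.det (Matrix.gram ℝ v)) := by
  by_cases hli : LinearIndependent ℝ v
  · set S := Submodule.span ℝ (range v) with hS
    have hfr : Module.finrank ℝ S = m := by
      rw [finrank_span_eq_card hli, Fintype.card_fin]
    have : FiniteDimensional ℝ S := FiniteDimensional.span_of_finite ℝ (finite_range v)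
    let v' : Fin m → S := fun i => ⟨v i, Submodule.subset_span (mem_range_self i)⟩
    let b : OrthonormalBasis (Fin m) ℝ S :=
      (stdOrthonormalBasis ℝ S).reindex (finCongr hfr)
    set T : Matrix (Fin m) (Fin m) ℝ := Matrix.of fun i j => b.repr (v' j) i with hT
    have hgram : Matrix.det (Matrix.gram ℝ v) = T.det ^ 2 := by
      have h1 : Matrix.gram ℝ v = Matrix.gram ℝ v' := rfl
      rw [h1, Matrix.gram_eq_conjTranspose_mul b v', Matrix.det_mul,
        Matrix.conjTranspose_eq_transpose_of_trivial, Matrix.det_transpose, sq]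
    -- In an orthonormal basis of the span of `v`, the matrix of pairings is the coordinate matrix
    -- times the values of the forms on unit vectors; the Gram determinant is the square of the
    -- coordinate determinant.
    have hmat : (Matrix.of fun i l => ℓ l (v i)) =
        T.transpose * Matrix.of fun a l => ℓ l (b a : V) := by
      ext i l
      have h1 : v i = ∑ a, b.repr (v' i) a • (b a : V) := by
        have h2 := b.sum_repr (v' i)
        have h3 := congrArg (Subtype.val : S → V) h2
        rw [show v i = (v' i : V) from rfl, ← h3]
        simp
      simp only [Matrix.of_apply, Matrix.mul_apply, Matrix.transpose_apply, hT]
      conv_lhs => rw [h1]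
      rw [map_sum]
      simp
    have hb : |(Matrix.of fun a l => ℓ l (b a : V)).det| ≤ m.factorial * ∏ l, c l := by
      refine abs_det_le_factorial_mul_prod fun a l => ?_
      refine (hc l (b a : V)).trans ?_
      have : ‖(b a : V)‖ = 1 := b.norm_eq_one a
      rw [this, mul_one]
    rw [hmat, Matrix.det_mul, Matrix.det_transpose, abs_mul, hgram, Real.sqrt_sq_eq_abs, mul_comm]
    gcongr
  -- For dependent vectors both sides vanish.
  · have hzero : Matrix.det (Matrix.of fun i l => ℓ l (v i)) = 0 := by
      rw [Fintype.linearIndependent_iff] at hli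
      push Not at hli
      obtain ⟨h, hh, i, hi⟩ := hli
      refine Matrix.exists_vecMul_eq_zero_iff.1 ⟨h, fun h0 => hi (by rw [h0]; rfl), ?_⟩
      ext l
      calc Matrix.vecMul h (Matrix.of fun i l => ℓ l (v i)) l = ∑ a, h a * ℓ l (v a) := rfl
        _ = ℓ l (∑ a, h a • v a) := by simp [map_sum]
        _ = 0 := by rw [hh, map_zero]
    have hg : Matrix.det (Matrix.gram ℝ v) = 0 := by
      by_contra hne
      exact hli (Matrix.linearIndependent_of_det_gram_ne_zero hne)
    rw [hzero, hg]
    simp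

end Gram

/-! ### Differentials of functions on the manifold -/

section ScalarDiff

variable {n : ℕ} {M : Type*} [TopologicalSpace M] [ChartedSpace (EuclideanSpace ℝ (Fin n)) M]

/-- The differential of a real function on a manifold, as a linear form on the tangent space. -/
noncomputable def scalarDiff (f : M → ℝ) (x : M) : TangentSpace (𝓡 n) x →L[ℝ] ℝ :=
  mfderiv (𝓡 n) 𝓘(ℝ, ℝ) f x

theorem scalarDiff_comp {E' : Type*} [NormedAddCommGroup E'] [NormedSpace ℝ E']
    {F : E' → ℝ} {e : M → E'} {x : M} (hF : DifferentiableAt ℝ F (e x))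
    (he : MDifferentiableAt (𝓡 n) 𝓘(ℝ, E') e x) (v : TangentSpace (𝓡 n) x) :
    scalarDiff (fun y => F (e y)) x v = fderiv ℝ F (e x) (mfderiv (𝓡 n) 𝓘(ℝ, E') e x v) := by
  have h1 := mfderiv_comp x hF.mdifferentiableAt he
  rw [mfderiv_eq_fderiv] at h1
  exact congrArg (fun L : TangentSpace (𝓡 n) x →L[ℝ] TangentSpace 𝓘(ℝ, ℝ) (F (e x)) => L v) h1

theorem scalarDiff_mfderiv {E' : Type*} [NormedAddCommGroup E'] [NormedSpace ℝ E']
    {g : M → ℝ} {f : E' → M} {x : E'} (hg : MDifferentiableAt (𝓡 n) 𝓘(ℝ, ℝ) g (f x))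
    (hf : MDifferentiableAt 𝓘(ℝ, E') (𝓡 n) f x) (w : E') :
    scalarDiff g (f x) (mfderiv 𝓘(ℝ, E') (𝓡 n) f x w) = fderiv ℝ (fun y => g (f y)) x w := by
  have h1 := mfderiv_comp x hg hf
  rw [mfderiv_eq_fderiv] at h1
  exact (congrArg (fun L : E' →L[ℝ] ℝ => L w) h1).symm

theorem scalarDiff_congr {f g : M → ℝ} {x : M} (h : f =ᶠ[𝓝 x] g) :
    scalarDiff (n := n) f x = scalarDiff g x := by
  have := h.mfderiv_eq (I := 𝓡 n) (I' := 𝓘(ℝ, ℝ))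
  exact this

theorem scalarDiff_mul {f g : M → ℝ} {x : M} (hf : MDifferentiableAt (𝓡 n) 𝓘(ℝ, ℝ) f x)
    (hg : MDifferentiableAt (𝓡 n) 𝓘(ℝ, ℝ) g x) (v : TangentSpace (𝓡 n) x) :
    scalarDiff (fun y => f y * g y) x v = f x * scalarDiff g x v + g x * scalarDiff f x v := by
  have h := hf.hasMFDerivAt.mul hg.hasMFDerivAt
  have h1 := h.mfderiv
  have h2 := congrArg (fun L : TangentSpace (𝓡 n) x →L[ℝ] ℝ => L v) h1
  exact h2

end ScalarDiff

section RiemannianBound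

variable {n : ℕ} {M : Type*} [TopologicalSpace M] [ChartedSpace (EuclideanSpace ℝ (Fin n)) M]
  [RiemannianBundle (fun x : M => TangentSpace (𝓡 n) x)]

attribute [local instance] normedAddCommGroupTangentSpaceVectorSpace
  normedSpaceTangentSpaceVectorSpace

/-- Continuity of the metric bounds the derivative of the chart at `x₀` near `x₀`, and `f` read in
that chart has a continuous derivative. -/
theorem eventually_abs_scalarDiff_le [IsManifold (𝓡 n) 1 M]
    [IsContinuousRiemannianBundle (EuclideanSpace ℝ (Fin n)) (fun x : M => TangentSpace (𝓡 n) x)]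
    {f : M → ℝ} (hf : ContMDiff (𝓡 n) 𝓘(ℝ, ℝ) 1 f) (x₀ : M) :
    ∃ C : ℝ, ∀ᶠ x in 𝓝 x₀, ∀ v : TangentSpace (𝓡 n) x, |scalarDiff f x v| ≤ C * ‖v‖ := by
  obtain ⟨C₁, hC₁0, hC₁⟩ := eventually_norm_mfderiv_extChartAt_lt (𝓡 n) x₀
  set e := extChartAt (𝓡 n) x₀ with he
  set F : EuclideanSpace ℝ (Fin n) → ℝ := fun y => f (e.symm y) with hF
  have hFc : ContDiffOn ℝ 1 F e.target := by
    rw [← contMDiffOn_iff_contDiffOn]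
    exact hf.comp_contMDiffOn (contMDiffOn_extChartAt_symm x₀)
  have ho : IsOpen e.target := isOpen_extChartAt_target x₀
  have hcont : ContinuousAt (fderiv ℝ F) (e x₀) :=
    (hFc.continuousOn_fderiv_of_isOpen ho le_rfl).continuousAt
      (ho.mem_nhds (mem_extChartAt_target x₀))
  have hbd : ∀ᶠ x in 𝓝 x₀, ‖fderiv ℝ F (e x)‖ < ‖fderiv ℝ F (e x₀)‖ + 1 := by
    have h1 : ContinuousAt (fun x => ‖fderiv ℝ F (e x)‖) x₀ :=
      (ContinuousAt.comp (f := e) hcont (continuousAt_extChartAt x₀)).norm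
    exact h1.eventually_lt_const (by linarith)
  refine ⟨(‖fderiv ℝ F (e x₀)‖ + 1) * C₁, ?_⟩
  filter_upwards [hC₁, hbd, extChartAt_source_mem_nhds (I := 𝓡 n) x₀] with x hx1 hx2 hx3 v
  have hFd : DifferentiableAt ℝ F (e x) :=
    (hFc.differentiableOn one_ne_zero).differentiableAt (ho.mem_nhds (e.map_source hx3))
  have hed : MDifferentiableAt (𝓡 n) 𝓘(ℝ, EuclideanSpace ℝ (Fin n)) e x :=
    mdifferentiableAt_extChartAt (by simpa [he] using hx3)
  have heq : f =ᶠ[𝓝 x] fun y => F (e y) := by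
    filter_upwards [extChartAt_source_mem_nhds' (I := 𝓡 n) hx3] with y hy
    simp only [hF]
    rw [e.left_inv hy]
  rw [scalarDiff_congr heq, scalarDiff_comp hFd hed]
  have h2 : ‖mfderiv (𝓡 n) 𝓘(ℝ, EuclideanSpace ℝ (Fin n)) e x v‖ ≤ C₁ * ‖v‖ :=
    (ContinuousLinearMap.le_opNorm _ v).trans (mul_le_mul_of_nonneg_right hx1.le (norm_nonneg _))
  refine ((fderiv ℝ F (e x)).le_opNorm _).trans ?_
  rw [mul_assoc]
  exact mul_le_mul hx2.le h2 (norm_nonneg _) (by positivity)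

/-- On a compact manifold the differential of a `C¹` function is bounded. -/
theorem exists_abs_scalarDiff_le [CompactSpace M] [IsManifold (𝓡 n) 1 M]
    [IsContinuousRiemannianBundle (EuclideanSpace ℝ (Fin n)) (fun x : M => TangentSpace (𝓡 n) x)]
    {f : M → ℝ} (hf : ContMDiff (𝓡 n) 𝓘(ℝ, ℝ) 1 f) :
    ∃ C : ℝ, 0 ≤ C ∧ ∀ (x : M) (v : TangentSpace (𝓡 n) x), |scalarDiff f x v| ≤ C * ‖v‖ := by
  choose C hC using eventually_abs_scalarDiff_le (n := n) hf
  obtain ⟨t, ht⟩ := CompactSpace.elim_nhds_subcover _ hC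
  refine ⟨∑ y ∈ t, |C y|, Finset.sum_nonneg fun _ _ => abs_nonneg _, fun x v => ?_⟩
  have hx : x ∈ ⋃ y ∈ t, {x | ∀ v : TangentSpace (𝓡 n) x, |scalarDiff f x v| ≤ C y * ‖v‖} := by
    rw [ht]; trivial
  simp only [mem_iUnion] at hx
  obtain ⟨y, hy, hxy⟩ := hx
  refine (hxy v).trans (mul_le_mul_of_nonneg_right ?_ (norm_nonneg _))
  exact (le_abs_self _).trans
    (Finset.single_le_sum (f := fun y => |C y|) (fun _ _ => abs_nonneg _) hy)

end RiemannianBound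

theorem abs_det_scalarDiff_le {n m : ℕ} {M : Type*} [TopologicalSpace M]
    [ChartedSpace (EuclideanSpace ℝ (Fin n)) M]
    [RiemannianBundle (fun x : M => TangentSpace (𝓡 n) x)] (g : Fin m → M → ℝ) (c : Fin m → ℝ)
    (hc : ∀ l x (v : TangentSpace (𝓡 n) x), |scalarDiff (g l) x v| ≤ c l * ‖v‖)
    (x : M) (v : Fin m → TangentSpace (𝓡 n) x) :
    |Matrix.det (Matrix.of fun i l => scalarDiff (g l) x (v i))| ≤
      m.factorial * (∏ l, c l) * Real.sqrt (Matrix.det (Matrix.gram ℝ v)) :=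
  abs_det_le_sqrt_det_gram (fun l => (scalarDiff (g l) x).toLinearMap) v fun l v => hc l x v

/-! ### Integrals over an immersed disk and its boundary -/

namespace ImmersedDisk

variable {n k : ℕ} {M : Type*} [TopologicalSpace M] [ChartedSpace (EuclideanSpace ℝ (Fin n)) M]
  (D : ImmersedDisk n M k)

/-- The pull-back of `dg₁ ∧ … ∧ dg_k` to a boundary piece. -/
noncomputable def wedgeDensity (g : Fin k → M → ℝ) (j : Fin D.numPieces) (u : Fin k → ℝ) : ℝ :=
  Matrix.det (Matrix.of fun i l => scalarDiff (g l) (D.toFun (D.piece j u)) (D.boundaryVec j u i))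

/-- The integral of `b dg₁ ∧ … ∧ dg_k` over the boundary. -/
noncomputable def wedgeIntegral (b : M → ℝ) (g : Fin k → M → ℝ) : ℝ :=
  ∑ j, ∫ u in unitCube k, b (D.toFun (D.piece j u)) * D.wedgeDensity g j u

theorem contDiffAt_comp {g : M → ℝ} (hg : ContMDiff (𝓡 n) 𝓘(ℝ, ℝ) 1 g) {x : Fin (k + 1) → ℝ}
    (hx : x ∈ D.carrier) : ContDiffAt ℝ 1 (fun y => g (D.toFun y)) x :=
  (hg.contMDiffAt.comp x (D.contMDiffAt x hx)).contDiffAt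

theorem scalarDiff_mfderiv_toFun {g : M → ℝ} (hg : ContMDiff (𝓡 n) 𝓘(ℝ, ℝ) 1 g)
    {x : Fin (k + 1) → ℝ} (hx : x ∈ D.carrier) (w : Fin (k + 1) → ℝ) :
    scalarDiff g (D.toFun x) (mfderiv 𝓘(ℝ, Fin (k + 1) → ℝ) (𝓡 n) D.toFun x w) =
      fderiv ℝ (fun y => g (D.toFun y)) x w :=
  scalarDiff_mfderiv (hg.mdifferentiableAt one_ne_zero)
    ((D.contMDiffAt x hx).mdifferentiableAt one_ne_zero) w

theorem wedgeDensity_eq {g : Fin k → M → ℝ} (hg : ∀ l, ContMDiff (𝓡 n) 𝓘(ℝ, ℝ) 1 (g l))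
    (j : Fin D.numPieces) {u : Fin k → ℝ} (hu : u ∈ unitCube k) :
    D.wedgeDensity g j u = Matrix.det (Matrix.of fun i l =>
      fderiv ℝ (fun y => g l (D.toFun y)) (D.piece j u) (D.pieceVec j u i)) := by
  rw [wedgeDensity]
  congr 1
  ext i l
  exact D.scalarDiff_mfderiv_toFun (hg l) (D.piece_mem_carrier j hu) _

theorem continuousOn_toFun_piece (j : Fin D.numPieces) :
    ContinuousOn (fun u => D.toFun (D.piece j u)) (unitCube k) := by
  have h : ContinuousOn D.toFun D.carrier := fun x hx =>
    (D.contMDiffAt x hx).continuousAt.continuousWithinAt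
  exact h.comp (D.continuousOn_piece j) fun u hu => D.piece_mem_carrier j hu

theorem continuousOn_wedgeDensity {g : Fin k → M → ℝ}
    (hg : ∀ l, ContMDiff (𝓡 n) 𝓘(ℝ, ℝ) 1 (g l)) (j : Fin D.numPieces) :
    ContinuousOn (D.wedgeDensity g j) (unitCube k) := by
  refine ContinuousOn.congr ?_ fun u hu => D.wedgeDensity_eq hg j hu
  have hdet : Continuous fun A : Matrix (Fin k) (Fin k) ℝ => A.det := continuous_id.matrix_det
  refine hdet.comp_continuousOn (continuousOn_pi.2 fun i => continuousOn_pi.2 fun l => ?_)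
  have h1 : ContinuousOn (fderiv ℝ fun y => g l (D.toFun y)) D.carrier := fun x hx =>
    ((D.contDiffAt_comp (hg l) hx).continuousAt_fderiv one_ne_zero).continuousWithinAt
  exact (h1.comp (D.continuousOn_piece j) fun u hu => D.piece_mem_carrier j hu).clm_apply
    (D.continuousOn_pieceVec j i)

theorem integrableOn_wedge {b : M → ℝ} (hb : Continuous b) {g : Fin k → M → ℝ}
    (hg : ∀ l, ContMDiff (𝓡 n) 𝓘(ℝ, ℝ) 1 (g l)) (j : Fin D.numPieces) :
    IntegrableOn (fun u => b (D.toFun (D.piece j u)) * D.wedgeDensity g j u) (unitCube k) :=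
  ((hb.comp_continuousOn (D.continuousOn_toFun_piece j)).mul
    (D.continuousOn_wedgeDensity hg j)).integrableOn_compact isCompact_unitCube

theorem wedgeIntegral_sub {b c : M → ℝ} (hb : Continuous b) (hc : Continuous c)
    {g : Fin k → M → ℝ} (hg : ∀ l, ContMDiff (𝓡 n) 𝓘(ℝ, ℝ) 1 (g l)) :
    D.wedgeIntegral (fun x => b x - c x) g = D.wedgeIntegral b g - D.wedgeIntegral c g := by
  simp only [wedgeIntegral]
  rw [← Finset.sum_sub_distrib]
  refine Finset.sum_congr rfl fun j _ => ?_
  rw [← integral_sub (D.integrableOn_wedge hb hg j) (D.integrableOn_wedge hc hg j)]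
  simp only [sub_mul]

/-- Stokes' formula for an immersed disk. -/
theorem wedgeIntegral_eq_integral_carrier {b : M → ℝ} (hb : ContMDiff (𝓡 n) 𝓘(ℝ, ℝ) 1 b)
    {g : Fin k → M → ℝ} (hg : ∀ l, ContMDiff (𝓡 n) 𝓘(ℝ, ℝ) 1 (g l)) :
    D.wedgeIntegral b g = ∫ x in D.carrier, Matrix.det (Matrix.of fun i l =>
      scalarDiff ((Fin.cons b g : Fin (k + 1) → M → ℝ) l) (D.toFun x)
        (mfderiv 𝓘(ℝ, Fin (k + 1) → ℝ) (𝓡 n) D.toFun x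
          (Pi.single i (1 : ℝ) : Fin (k + 1) → ℝ))) := by
  -- Composed with the immersion, even smooth functions on `M` are only `C^1`, hence the need for
  -- the Euclidean formula at this regularity.
  have hst := D.stokes (b := fun y => b (D.toFun y)) (g := fun l y => g l (D.toFun y))
    (fun x hx => D.contDiffAt_comp hb hx) (fun l x hx => D.contDiffAt_comp (hg l) hx)
  have h1 : D.wedgeIntegral b g = ∑ j, ∫ u in unitCube k, b (D.toFun (D.piece j u)) *
        Matrix.det (Matrix.of fun i l =>
          fderiv ℝ (fun y => g l (D.toFun y)) (D.piece j u) (D.pieceVec j u i)) := by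
    refine Finset.sum_congr rfl fun j _ => ?_
    refine setIntegral_congr_fun isCompact_unitCube.measurableSet fun u hu => ?_
    simp only [D.wedgeDensity_eq hg j hu]
  rw [h1, ← hst]
  refine setIntegral_congr_fun D.isCompact_carrier.measurableSet fun x hx => ?_
  rw [detCons_apply, ← Matrix.det_transpose]
  congr 1
  ext i l
  rw [Matrix.transpose_apply, Matrix.of_apply, Matrix.of_apply]
  refine Fin.cases ?_ (fun l => ?_) l
  · exact (D.scalarDiff_mfderiv_toFun hb hx _).symm
  · exact (D.scalarDiff_mfderiv_toFun (hg l) hx _).symm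

variable [RiemannianBundle (fun x : M => TangentSpace (𝓡 n) x)]

theorem abs_wedgeDensity_le {g : Fin k → M → ℝ} {C : ℝ}
    (hC : ∀ l x (v : TangentSpace (𝓡 n) x), |scalarDiff (g l) x v| ≤ C * ‖v‖)
    (j : Fin D.numPieces) (u : Fin k → ℝ) :
    |D.wedgeDensity g j u| ≤ k.factorial * C ^ k *
      Real.sqrt (Matrix.det (Matrix.gram ℝ (D.boundaryVec j u))) := by
  have := abs_det_scalarDiff_le g (fun _ => C) hC _ (D.boundaryVec j u)
  simpa [wedgeDensity] using this

/-- The pointwise bound on the density is integrated in `ℝ≥0∞`, where no integrability of the volume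
density has to be known. -/
theorem ofReal_abs_wedgeIntegral_le_boundaryVol {b : M → ℝ} {g : Fin k → M → ℝ} {C δ : ℝ}
    (hC0 : 0 ≤ C) (hC : ∀ l x (v : TangentSpace (𝓡 n) x), |scalarDiff (g l) x v| ≤ C * ‖v‖)
    (hδ : ∀ x, |b x| ≤ δ) :
    ENNReal.ofReal |D.wedgeIntegral b g| ≤
      ENNReal.ofReal (δ * (k.factorial * C ^ k)) * D.boundaryVol := by
  have hterm : ∀ j, ENNReal.ofReal |∫ u in unitCube k,
      b (D.toFun (D.piece j u)) * D.wedgeDensity g j u| ≤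
      ENNReal.ofReal (δ * (k.factorial * C ^ k)) * ∫⁻ u in unitCube k,
        ENNReal.ofReal (Real.sqrt (Matrix.det (Matrix.gram ℝ (D.boundaryVec j u)))) := by
    intro j
    rw [← Real.enorm_eq_ofReal_abs, ← lintegral_const_mul' _ _ ENNReal.ofReal_ne_top]
    refine (enorm_integral_le_lintegral_enorm _).trans (lintegral_mono fun u => ?_)
    have hδ0 : 0 ≤ δ := (abs_nonneg _).trans (hδ (D.toFun (D.piece j u)))
    simp only
    rw [Real.enorm_eq_ofReal_abs, ← ENNReal.ofReal_mul (by positivity), abs_mul]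
    refine ENNReal.ofReal_le_ofReal ?_
    rw [mul_assoc]
    exact mul_le_mul (hδ _) (D.abs_wedgeDensity_le hC j u) (abs_nonneg _) hδ0
  calc ENNReal.ofReal |D.wedgeIntegral b g|
      ≤ ENNReal.ofReal (∑ j, |∫ u in unitCube k,
          b (D.toFun (D.piece j u)) * D.wedgeDensity g j u|) :=
        ENNReal.ofReal_le_ofReal (Finset.abs_sum_le_sum_abs _ _)
    _ = ∑ j, ENNReal.ofReal |∫ u in unitCube k,
          b (D.toFun (D.piece j u)) * D.wedgeDensity g j u| :=
        ENNReal.ofReal_sum_of_nonneg fun _ _ => abs_nonneg _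
    _ ≤ _ := by
        rw [boundaryVol, Finset.mul_sum]
        exact Finset.sum_le_sum fun j _ => hterm j

/-- Stokes replaces the boundary integral by that of `db ∧ dg₁ ∧ … ∧ dg_k` over the disk, so that
only the differential of `b` counts, not its size. -/
theorem ofReal_abs_wedgeIntegral_le_vol {b : M → ℝ} (hb : ContMDiff (𝓡 n) 𝓘(ℝ, ℝ) 1 b)
    {g : Fin k → M → ℝ} (hg : ∀ l, ContMDiff (𝓡 n) 𝓘(ℝ, ℝ) 1 (g l)) {C Cb : ℝ} (hC0 : 0 ≤ C)
    (hCb0 : 0 ≤ Cb) (hC : ∀ l x (v : TangentSpace (𝓡 n) x), |scalarDiff (g l) x v| ≤ C * ‖v‖)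
    (hCb : ∀ x (v : TangentSpace (𝓡 n) x), |scalarDiff b x v| ≤ Cb * ‖v‖) :
    ENNReal.ofReal |D.wedgeIntegral b g| ≤
      ENNReal.ofReal (Cb * ((k + 1).factorial * C ^ k)) * D.vol := by
  rw [D.wedgeIntegral_eq_integral_carrier hb hg, vol, ← Real.enorm_eq_ofReal_abs,
    ← lintegral_const_mul' _ _ ENNReal.ofReal_ne_top]
  refine (enorm_integral_le_lintegral_enorm _).trans (lintegral_mono fun x => ?_)
  simp only
  rw [Real.enorm_eq_ofReal_abs, ← ENNReal.ofReal_mul (by positivity)]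
  refine ENNReal.ofReal_le_ofReal ?_
  have hcons : ∀ l x (v : TangentSpace (𝓡 n) x),
      |scalarDiff ((Fin.cons b g : Fin (k + 1) → M → ℝ) l) x v| ≤
        (Fin.cons Cb fun _ => C : Fin (k + 1) → ℝ) l * ‖v‖ := fun l x v => by
    refine Fin.cases ?_ (fun l => ?_) l
    · exact hCb x v
    · exact hC l x v
  refine (abs_det_scalarDiff_le _ _ hcons (D.toFun x) _).trans (le_of_eq ?_)
  rw [Fin.prod_univ_succ]
  simp only [Fin.cons_zero, Fin.cons_succ, Finset.prod_const, Finset.card_univ, Fintype.card_fin]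
  ring

end ImmersedDisk

/-! ### Forms in charts -/

section Coefficients

/-- The expansion of an alternating form in the basis `dx_I`, `I` increasing. -/
theorem alternatingMap_eq_sum_mul_det {n k : ℕ}
    (β : (EuclideanSpace ℝ (Fin n)) [⋀^Fin k]→ₗ[ℝ] ℝ) (ξ : Fin k → EuclideanSpace ℝ (Fin n)) :
    β ξ = ∑ I : Fin k ↪o Fin n, β (fun i => EuclideanSpace.single (I i) (1 : ℝ)) *
      Matrix.det (Matrix.of fun i l => ξ i (I l)) := by
  set b := (EuclideanSpace.basisFun (Fin n) ℝ).toBasis with hb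
  -- As a linear functional on the exterior power, `β` is evaluated on the basis `e_I`; the
  -- coordinates of `ξ₁ ∧ … ∧ ξ_k` are the minors of `ξ`.
  set f := exteriorPower.alternatingMapLinearEquiv β with hf
  have hfβ : ∀ η, f (exteriorPower.ιMulti ℝ k η) = β η := fun η => by
    simp [hf]
  rw [← hfβ ξ, ← (b.exteriorPower k).sum_repr (exteriorPower.ιMulti ℝ k ξ), map_sum]
  rw [← Set.powersetCard.ofFinEmbEquiv.sum_comp]
  refine Finset.sum_congr rfl fun I _ => ?_
  rw [map_smul, smul_eq_mul, mul_comm, exteriorPower.basis_apply,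
    exteriorPower.ιMulti_family, hfβ, ← Module.Basis.coord_apply, exteriorPower.basis_coord,
    exteriorPower.ιMultiDual_apply_ιMulti, Equiv.symm_apply_apply]
  congr 2
  ext i
  simp [hb]

variable {n k : ℕ} {M : Type*} [TopologicalSpace M] [ChartedSpace (EuclideanSpace ℝ (Fin n)) M]

theorem mfderiv_symm_mfderiv {φ : OpenPartialHomeomorph M (EuclideanSpace ℝ (Fin n))}
    (hφ : φ ∈ IsManifold.maximalAtlas (𝓡 n) ∞ M) {y : EuclideanSpace ℝ (Fin n)}
    (hy : y ∈ φ.target) (v : TangentSpace (𝓡 n) (φ.symm y)) :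
    mfderiv (𝓡 n) (𝓡 n) φ.symm y (mfderiv (𝓡 n) (𝓡 n) φ (φ.symm y) v) = v := by
  have hx : φ.symm y ∈ φ.source := φ.map_target hy
  have hyx : φ (φ.symm y) = y := φ.right_inv hy
  have h1 : MDifferentiableAt (𝓡 n) (𝓡 n) φ (φ.symm y) :=
    ((contMDiffOn_of_mem_maximalAtlas hφ).contMDiffAt
      (φ.open_source.mem_nhds hx)).mdifferentiableAt (by simp)
  have h2 : MDifferentiableAt (𝓡 n) (𝓡 n) φ.symm y :=
    ((contMDiffOn_symm_of_mem_maximalAtlas hφ).contMDiffAt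
      (φ.open_target.mem_nhds hy)).mdifferentiableAt (by simp)
  have h3 := mfderiv_comp_of_eq h2 h1 hyx
  have h4 : φ.symm ∘ φ =ᶠ[𝓝 (φ.symm y)] id := by
    filter_upwards [φ.open_source.mem_nhds hx] with z hz
    exact φ.left_inv hz
  rw [h4.mfderiv_eq, mfderiv_id] at h3
  have h5 := congrArg (fun L : EuclideanSpace ℝ (Fin n) →L[ℝ] EuclideanSpace ℝ (Fin n) => L v) h3
  -- The chain rule yields the derivative at `φ (φ.symm y)`, equal to `y` only propositionally;
  -- stating the change of base point in the model space avoids a cast.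
  have h6 : ∀ z, z = y → ∀ w : EuclideanSpace ℝ (Fin n),
      (show EuclideanSpace ℝ (Fin n) from mfderiv (𝓡 n) (𝓡 n) φ.symm z w) =
        (show EuclideanSpace ℝ (Fin n) from mfderiv (𝓡 n) (𝓡 n) φ.symm y w) := by
    rintro z rfl w
    rfl
  exact ((h6 _ hyx _).symm.trans h5.symm)

/-- The expansion of a form in a chart. -/
theorem DiffForm.apply_eq_sum_coeff (α : DiffForm n M k)
    {φ : OpenPartialHomeomorph M (EuclideanSpace ℝ (Fin n))}
    (hφ : φ ∈ IsManifold.maximalAtlas (𝓡 n) ∞ M) {x : M} (hx : x ∈ φ.source)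
    (v : Fin k → TangentSpace (𝓡 n) x) :
    α x v = ∑ I : Fin k ↪o Fin n, α.coeff φ I (φ x) *
      Matrix.det (Matrix.of fun i l => scalarDiff (fun z => φ z (I l)) x (v i)) := by
  -- Coefficients live in the fibre over `φ.symm y`; writing `x` in this form avoids transport
  -- between tangent spaces.
  obtain ⟨y, hy, rfl⟩ : ∃ y ∈ φ.target, φ.symm y = x := ⟨φ x, φ.map_source hx, φ.left_inv hx⟩
  have hyx : φ (φ.symm y) = y := φ.right_inv hy
  rw [hyx]
  have hmd : MDifferentiableAt (𝓡 n) (𝓡 n) φ (φ.symm y) :=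
    ((contMDiffOn_of_mem_maximalAtlas hφ).contMDiffAt
      (φ.open_source.mem_nhds hx)).mdifferentiableAt (by simp)
  let L : EuclideanSpace ℝ (Fin n) →ₗ[ℝ] TangentSpace (𝓡 n) (φ.symm y) :=
    (mfderiv (𝓡 n) (𝓡 n) φ.symm y).toLinearMap
  let ξ : Fin k → EuclideanSpace ℝ (Fin n) := fun i => mfderiv (𝓡 n) (𝓡 n) φ (φ.symm y) (v i)
  have hL : ∀ i, L (ξ i) = v i := fun i => mfderiv_symm_mfderiv hφ hy (v i)
  have h1 := alternatingMap_eq_sum_mul_det ((α (φ.symm y)).toAlternatingMap.compLinearMap L) ξ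
  have h2 : ((α (φ.symm y)).toAlternatingMap.compLinearMap L) ξ = α (φ.symm y) v := by
    change α (φ.symm y) (fun i => L (ξ i)) = _
    simp_rw [hL]
  rw [← h2, h1]
  refine Finset.sum_congr rfl fun I _ => ?_
  congr 1
  congr 1
  ext i l
  have h3 := scalarDiff_comp (F := EuclideanSpace.proj (𝕜 := ℝ) (I l)) (e := φ)
    (EuclideanSpace.proj (𝕜 := ℝ) (I l)).differentiableAt hmd (v i)
  rw [ContinuousLinearMap.fderiv] at h3
  exact h3.symm

end Coefficients

/-! ### Consequences of a finite Hölder norm -/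

section Holder

theorem abs_le_of_holderNormOn_le {X : Type*} [PseudoEMetricSpace X] {θ : ℝ≥0} {s : Set X}
    {f : X → ℝ} {N : ℝ≥0∞} (hN : N ≠ ⊤) (h : holderNormOn θ s f ≤ N) {x : X} (hx : x ∈ s) :
    |f x| ≤ N.toReal := by
  have h1 : ‖f x‖ₑ ≤ N :=
    ((le_iSup₂ (f := fun x (_ : x ∈ s) => ‖f x‖ₑ) x hx).trans le_self_add).trans h
  rw [← Real.norm_eq_abs, ← toReal_enorm]
  exact ENNReal.toReal_mono hN h1

theorem abs_sub_le_of_holderNormOn_le {X : Type*} [MetricSpace X] {θ : ℝ≥0} {s : Set X}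
    {f : X → ℝ} {N : ℝ≥0∞} (hN : N ≠ ⊤) (h : holderNormOn θ s f ≤ N) {x y : X} (hx : x ∈ s)
    (hy : y ∈ s) : |f x - f y| ≤ N.toReal * dist x y ^ (θ : ℝ) := by
  have h1 : eHolderNorm θ (fun x : s => f x) ≤ N := le_add_self.trans h
  have h2 : MemHolder θ (fun x : s => f x) := eHolderNorm_lt_top.1 (h1.trans_lt hN.lt_top)
  have h3 := h2.holderWith.dist_le ⟨x, hx⟩ ⟨y, hy⟩
  rw [Real.dist_eq, Subtype.dist_eq] at h3
  refine h3.trans ?_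
  gcongr
  exact ENNReal.toReal_mono hN h1

theorem continuousOn_of_holderNormOn_le {X : Type*} [MetricSpace X] {θ : ℝ≥0} (hθ : 0 < θ)
    {s : Set X} {f : X → ℝ} {N : ℝ≥0∞} (hN : N ≠ ⊤) (h : holderNormOn θ s f ≤ N) :
    ContinuousOn f s := by
  have h1 : eHolderNorm θ (fun x : s => f x) ≤ N := le_add_self.trans h
  have h2 : MemHolder θ (fun x : s => f x) := eHolderNorm_lt_top.1 (h1.trans_lt hN.lt_top)
  rw [continuousOn_iff_continuous_domRestrict]
  exact h2.holderWith.continuous hθ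

end Holder

/-! ### Choice of the scale -/

section Interpolation

/-- Optimization of the scale in `ε ^ θ P + ε ^ (θ - 1) V`. -/
theorem le_rpow_mul_rpow_of_forall_le {Z N P V : ℝ≥0∞} {θ : ℝ} (hθ₀ : 0 < θ) (hθ₁ : θ < 1)
    (hN : N ≠ ⊤) (hP : P ≠ ⊤) (hZP : Z ≤ N * P)
    (hZ : ∀ ε : ℝ, 0 < ε → ε ≤ 1 →
      Z ≤ N * (ENNReal.ofReal (ε ^ θ) * P + ENNReal.ofReal (ε ^ (θ - 1)) * V)) :
    Z ≤ 2 * N * P ^ (1 - θ) * V ^ θ := by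
  -- If `P ≤ V`, split `P = P ^ (1 - θ) * P ^ θ` and enlarge the last factor; this covers `V = ⊤`.
  -- Otherwise `V / P` is an admissible scale, unless `V = 0`, when `ε` tends to 0.
  rcases le_or_gt P V with hPV | hVP
  · calc Z ≤ N * P := hZP
      _ = N * (P ^ (1 - θ) * P ^ θ) := by
        rw [← ENNReal.rpow_add_of_nonneg _ _ (by linarith) hθ₀.le, sub_add_cancel,
          ENNReal.rpow_one]
      _ ≤ N * (P ^ (1 - θ) * V ^ θ) := by gcongr
      _ ≤ 2 * (N * (P ^ (1 - θ) * V ^ θ)) := le_mul_of_one_le_left' one_le_two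
      _ = 2 * N * P ^ (1 - θ) * V ^ θ := by ring
  · have hV : V ≠ ⊤ := hVP.ne_top
    rcases eq_or_ne V 0 with rfl | hV0
    · have hlim : Filter.Tendsto (fun ε : ℝ => N * (ENNReal.ofReal (ε ^ θ) * P)) (𝓝[>] 0)
          (𝓝 (N * (ENNReal.ofReal 0 * P))) := by
        refine ENNReal.Tendsto.const_mul (ENNReal.Tendsto.mul_const ?_ (Or.inr hP)) (Or.inr hN)
        refine ENNReal.tendsto_ofReal ?_
        have h1 : Filter.Tendsto (fun ε : ℝ => ε ^ θ) (𝓝 0) (𝓝 (0 ^ θ)) :=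
          (Real.continuousAt_rpow_const 0 θ (Or.inr hθ₀.le)).tendsto
        rw [Real.zero_rpow hθ₀.ne'] at h1
        exact h1.mono_left nhdsWithin_le_nhds
      have h0 : Z ≤ N * (ENNReal.ofReal 0 * P) := by
        refine ge_of_tendsto hlim ?_
        have hle : ∀ᶠ ε : ℝ in 𝓝[>] 0, ε ≤ 1 :=
          nhdsWithin_le_nhds (eventually_le_nhds zero_lt_one)
        filter_upwards [self_mem_nhdsWithin, hle] with ε hε hε1
        have := hZ ε hε hε1
        simpa using this
      refine h0.trans ?_
      simp
    · set p := P.toReal with hp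
      set v := V.toReal with hv
      have hv0 : 0 < v := ENNReal.toReal_pos hV0 hV
      have hvp : v < p := (ENNReal.toReal_lt_toReal hV hP).2 hVP
      have hp0 : 0 < p := hv0.trans hvp
      have hPp : P = ENNReal.ofReal p := (ENNReal.ofReal_toReal hP).symm
      have hVv : V = ENNReal.ofReal v := (ENNReal.ofReal_toReal hV).symm
      -- At this `ε` both terms equal `p ^ (1 - θ) * v ^ θ`, whence the factor 2.
      have h1 := hZ (v / p) (by positivity) ((div_le_one hp0).2 hvp.le)
      have e1 : (v / p) ^ θ * p = p ^ (1 - θ) * v ^ θ := by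
        rw [Real.div_rpow hv0.le hp0.le, Real.rpow_sub hp0, Real.rpow_one]
        field_simp
      have e2 : (v / p) ^ (θ - 1) * v = p ^ (1 - θ) * v ^ θ := by
        rw [Real.div_rpow hv0.le hp0.le, Real.rpow_sub hp0, Real.rpow_sub hp0, Real.rpow_sub hv0,
          Real.rpow_one, Real.rpow_one]
        field_simp
      refine h1.trans (le_of_eq ?_)
      rw [hPp, hVv, ← ENNReal.ofReal_mul (by positivity), ← ENNReal.ofReal_mul (by positivity), e1,
        e2, ENNReal.ofReal_rpow_of_pos hp0, ENNReal.ofReal_rpow_of_pos hv0,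
        ENNReal.ofReal_mul (by positivity)]
      ring

end Interpolation

/-! ### Localization and the estimate in one chart -/

section Globalization

variable {n k : ℕ} {M : Type*} [TopologicalSpace M] [ChartedSpace (EuclideanSpace ℝ (Fin n)) M]

/-- A chart can be extended from a closed subset of its domain to a smooth map on `M`. -/
theorem exists_contMDiff_eventuallyEq_chart [T2Space M] [CompactSpace M] [IsManifold (𝓡 n) ∞ M]
    {φ : OpenPartialHomeomorph M (EuclideanSpace ℝ (Fin n))}
    (hφ : φ ∈ IsManifold.maximalAtlas (𝓡 n) ∞ M) {s : Set M} (hs : IsClosed s)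
    (hsφ : s ⊆ φ.source) :
    ∃ X : M → EuclideanSpace ℝ (Fin n), ContMDiff (𝓡 n) (𝓡 n) ∞ X ∧ ∀ x ∈ s, X =ᶠ[𝓝 x] φ := by
  have : LocallyCompactSpace M := ChartedSpace.locallyCompactSpace (EuclideanSpace ℝ (Fin n)) M
  obtain ⟨t, ht, hst, htφ⟩ := exists_compact_between hs.isCompact φ.open_source hsφ
  obtain ⟨η, hη1, hη0, -⟩ := exists_contMDiffMap_one_nhds_of_subset_interior (n := (⊤ : ℕ∞))
    (𝓡 n) hs hst
  refine ⟨fun x => η x • φ x, fun x => ?_, fun x hx => ?_⟩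
  · by_cases hx : x ∈ φ.source
    · exact η.contMDiff.contMDiffAt.smul
        ((contMDiffOn_of_mem_maximalAtlas hφ).contMDiffAt (φ.open_source.mem_nhds hx))
    · have h0 : (fun x => η x • φ x) =ᶠ[𝓝 x] fun _ => 0 := by
        filter_upwards [ht.isClosed.isOpen_compl.mem_nhds fun h => hx (htφ h)] with y hy
        rw [hη0 y hy, zero_smul]
      exact contMDiffAt_const.congr_of_eventuallyEq h0
  · filter_upwards [Filter.Eventually.filter_mono (nhds_le_nhdsSet hx) hη1] with y hy
    rw [hy, one_smul]

theorem EuclideanSpace.norm_le_sum_abs (w : EuclideanSpace ℝ (Fin n)) : ‖w‖ ≤ ∑ l, |w l| := by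
  conv_lhs => rw [← (EuclideanSpace.basisFun (Fin n) ℝ).sum_repr w]
  refine (norm_sum_le _ _).trans (Finset.sum_le_sum fun l _ => ?_)
  simp [norm_smul]

/-- Coefficients are controlled only on the image of their chart. The cutoff makes them continuous
on all of `M`, which gives the integrability needed to split the boundary integral. -/
theorem continuous_mul_comp_of_tsupport_subset {Y E : Type*} [TopologicalSpace Y]
    [TopologicalSpace E] {χ : Y → ℝ} (hχ : Continuous χ) {X : Y → E} (hX : Continuous X)
    {a : E → ℝ} {s : Set E} (hs : IsOpen s) (ha : ContinuousOn a s)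
    (hχs : ∀ x ∈ tsupport χ, X x ∈ s) : Continuous fun x => χ x * a (X x) := by
  refine continuous_iff_continuousAt.2 fun x => ?_
  by_cases hx : x ∈ tsupport χ
  · exact hχ.continuousAt.mul (ContinuousAt.comp (f := X)
      (ha.continuousAt (hs.mem_nhds (hχs x hx))) hX.continuousAt)
  · have h0 : (fun x => χ x * a (X x)) =ᶠ[𝓝 x] fun _ => 0 := by
      filter_upwards [(isClosed_tsupport χ).isOpen_compl.mem_nhds hx] with y hy
      rw [image_eq_zero_of_notMem_tsupport hy, zero_mul]
    exact continuousAt_const.congr h0.symm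

/-- The boundary integral of a form, cut up by a partition of unity and expanded in charts. -/
theorem ImmersedDisk.boundaryIntegral_eq_sum_wedgeIntegral (D : ImmersedDisk n M k)
    (α : DiffForm n M k) {ι : Type*} [Fintype ι]
    {φ : ι → OpenPartialHomeomorph M (EuclideanSpace ℝ (Fin n))}
    (hφ : ∀ i, φ i ∈ IsManifold.maximalAtlas (𝓡 n) ∞ M) {χ : ι → M → ℝ}
    (hχ1 : ∀ x, ∑ i, χ i x = 1) (hχφ : ∀ i, tsupport (χ i) ⊆ (φ i).source)
    {X : ι → M → EuclideanSpace ℝ (Fin n)} (hX : ∀ i, ContMDiff (𝓡 n) (𝓡 n) 1 (X i))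
    (hXφ : ∀ i, ∀ x ∈ tsupport (χ i), X i =ᶠ[𝓝 x] φ i)
    (hcont : ∀ i (I : Fin k ↪o Fin n), Continuous fun x => χ i x * α.coeff (φ i) I (X i x)) :
    D.boundaryIntegral α = ∑ i, ∑ I : Fin k ↪o Fin n,
      D.wedgeIntegral (fun x => χ i x * α.coeff (φ i) I (X i x)) fun l x => X i x (I l) := by
  have hpt : ∀ x (v : Fin k → TangentSpace (𝓡 n) x), α x v = ∑ i, ∑ I : Fin k ↪o Fin n,
      χ i x * α.coeff (φ i) I (X i x) *
        Matrix.det (Matrix.of fun p l => scalarDiff (fun z => X i z (I l)) x (v p)) := by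
    intro x v
    rw [← one_mul (α x v), ← hχ1 x, Finset.sum_mul]
    refine Finset.sum_congr rfl fun i _ => ?_
    -- On the support of `χ i` the global map `X i` agrees with the chart near `x`, so the
    -- differentials agree too; elsewhere the term is zero.
    by_cases hx : x ∈ tsupport (χ i)
    · rw [α.apply_eq_sum_coeff (hφ i) (hχφ i hx) v, Finset.mul_sum]
      refine Finset.sum_congr rfl fun I _ => ?_
      have h1 : ∀ l, scalarDiff (n := n) (fun z => X i z (I l)) x =
          scalarDiff (fun z => φ i z (I l)) x := fun l => by
        refine scalarDiff_congr ?_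
        filter_upwards [hXφ i x hx] with y hy
        rw [hy]
      simp only [h1]
      rw [(hXφ i x hx).eq_of_nhds, mul_assoc]
    · simp [image_eq_zero_of_notMem_tsupport hx]
  have hg : ∀ i (I : Fin k ↪o Fin n) l, ContMDiff (𝓡 n) 𝓘(ℝ, ℝ) 1 fun x => X i x (I l) :=
    fun i I l => (EuclideanSpace.proj (𝕜 := ℝ) (I l)).contDiff.contMDiff.comp (hX i)
  have hinteg : ∀ j, ∫ u in unitCube k, α (D.toFun (D.piece j u)) (D.boundaryVec j u) =
      ∑ i, ∑ I : Fin k ↪o Fin n, ∫ u in unitCube k,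
        χ i (D.toFun (D.piece j u)) * α.coeff (φ i) I (X i (D.toFun (D.piece j u))) *
          D.wedgeDensity (fun l x => X i x (I l)) j u := fun j => by
    have hptj : ∀ u, α (D.toFun (D.piece j u)) (D.boundaryVec j u) =
        ∑ i, ∑ I : Fin k ↪o Fin n,
          χ i (D.toFun (D.piece j u)) * α.coeff (φ i) I (X i (D.toFun (D.piece j u))) *
            D.wedgeDensity (fun l x => X i x (I l)) j u := fun u => hpt _ _
    simp_rw [hptj]
    rw [integral_finsetSum _ fun i _ => integrable_finsetSum _ fun I _ =>
      D.integrableOn_wedge (hcont i I) (hg i I) j]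
    refine Finset.sum_congr rfl fun i _ => ?_
    rw [integral_finsetSum _ fun I _ => D.integrableOn_wedge (hcont i I) (hg i I) j]
  rw [ImmersedDisk.boundaryIntegral, Finset.sum_congr rfl fun j _ => hinteg j, Finset.sum_comm]
  refine Finset.sum_congr rfl fun i _ => ?_
  rw [Finset.sum_comm]
  rfl

variable [RiemannianBundle (fun x : M => TangentSpace (𝓡 n) x)]

/-- Product rule: `χ dF` gives `L` times the norm of `dX`, at most the sum of its `n` coordinates,
and `F dχ` gives `H * C`. -/
theorem abs_scalarDiff_mul_comp_le {χ : M → ℝ} (hχ : ContMDiff (𝓡 n) 𝓘(ℝ, ℝ) 1 χ)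
    (hχ1 : ∀ x, |χ x| ≤ 1) {X : M → EuclideanSpace ℝ (Fin n)} (hX : ContMDiff (𝓡 n) (𝓡 n) 1 X)
    {C H L : ℝ} (hH : 0 ≤ H) (hL : 0 ≤ L)
    (hCχ : ∀ x (v : TangentSpace (𝓡 n) x), |scalarDiff χ x v| ≤ C * ‖v‖)
    (hCX : ∀ l x (v : TangentSpace (𝓡 n) x), |scalarDiff (fun z => X z l) x v| ≤ C * ‖v‖)
    {F : EuclideanSpace ℝ (Fin n) → ℝ} (hF : Differentiable ℝ F) (hFH : ∀ y, |F y| ≤ H)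
    (hFL : ∀ y, ‖fderiv ℝ F y‖ ≤ L) (x : M) (v : TangentSpace (𝓡 n) x) :
    |scalarDiff (fun z => χ z * F (X z)) x v| ≤ (L * (n * C) + H * C) * ‖v‖ := by
  have hXd : MDifferentiableAt (𝓡 n) (𝓡 n) X x := hX.mdifferentiableAt one_ne_zero
  have hFX : MDifferentiableAt (𝓡 n) 𝓘(ℝ, ℝ) (fun z => F (X z)) x :=
    (hF (X x)).mdifferentiableAt.comp x hXd
  rw [scalarDiff_mul (hχ.mdifferentiableAt one_ne_zero) hFX, scalarDiff_comp (hF (X x)) hXd]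
  let w : EuclideanSpace ℝ (Fin n) := mfderiv (𝓡 n) (𝓡 n) X x v
  have hw : ‖w‖ ≤ n * C * ‖v‖ := by
    refine (EuclideanSpace.norm_le_sum_abs w).trans ?_
    have h1 : ∀ l ∈ Finset.univ, |w l| ≤ C * ‖v‖ := fun l _ => by
      have h2 := scalarDiff_comp (F := EuclideanSpace.proj (𝕜 := ℝ) l) (e := X)
        (EuclideanSpace.proj (𝕜 := ℝ) l).differentiableAt hXd v
      rw [ContinuousLinearMap.fderiv] at h2
      have h3 : w l = scalarDiff (fun z => X z l) x v := h2.symm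
      rw [h3]
      exact hCX l x v
    refine (Finset.sum_le_card_nsmul _ _ _ h1).trans (le_of_eq ?_)
    rw [Finset.card_univ, Fintype.card_fin, nsmul_eq_mul, mul_assoc]
  have h4 : |fderiv ℝ F (X x) w| ≤ L * (n * C * ‖v‖) :=
    ((fderiv ℝ F (X x)).le_opNorm w).trans (mul_le_mul (hFL _) hw (norm_nonneg _) hL)
  refine (abs_add_le _ _).trans ?_
  rw [abs_mul, abs_mul]
  have h5 : |χ x| * |fderiv ℝ F (X x) w| ≤ 1 * (L * (n * C * ‖v‖)) :=
    mul_le_mul (hχ1 x) h4 (abs_nonneg _) zero_le_one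
  have h6 : |F (X x)| * |scalarDiff χ x v| ≤ H * (C * ‖v‖) :=
    mul_le_mul (hFH _) (hCχ x v) (abs_nonneg _) hH
  calc _ ≤ 1 * (L * (n * C * ‖v‖)) + H * (C * ‖v‖) := add_le_add h5 h6
    _ = _ := by ring

namespace ImmersedDisk

variable (D : ImmersedDisk n M k)

/-- The estimate for a Hölder form `χ a dx_I` supported in a chart, at scale `ε`. -/
theorem ofReal_abs_wedgeIntegral_le_of_holder {χ : M → ℝ} (hχ : ContMDiff (𝓡 n) 𝓘(ℝ, ℝ) 1 χ)
    (hχ1 : ∀ x, |χ x| ≤ 1) {X : M → EuclideanSpace ℝ (Fin n)} (hX : ContMDiff (𝓡 n) (𝓡 n) 1 X)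
    {C H θ ε : ℝ} (hC0 : 0 ≤ C) (hH : 0 ≤ H) (hθ₀ : 0 ≤ θ) (hθ₁ : θ ≤ 1) (hε : 0 < ε)
    (hε1 : ε ≤ 1)
    (hCχ : ∀ x (v : TangentSpace (𝓡 n) x), |scalarDiff χ x v| ≤ C * ‖v‖)
    (hCX : ∀ l x (v : TangentSpace (𝓡 n) x), |scalarDiff (fun z => X z l) x v| ≤ C * ‖v‖)
    {a : EuclideanSpace ℝ (Fin n) → ℝ} {s : Set (EuclideanSpace ℝ (Fin n))}
    (hb : ∀ y ∈ s, |a y| ≤ H) (hh : ∀ y ∈ s, ∀ z ∈ s, |a y - a z| ≤ H * dist y z ^ θ)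
    (hχs : ∀ x ∈ tsupport χ, X x ∈ s) (hcont : Continuous fun x => χ x * a (X x))
    (I : Fin k → Fin n) :
    ENNReal.ofReal |D.wedgeIntegral (fun x => χ x * a (X x)) fun l x => X x (I l)| ≤
      ENNReal.ofReal (H * ((2 + n * C + C) * ((k + 1).factorial * C ^ k))) *
        (ENNReal.ofReal (ε ^ θ) * D.boundaryVol + ENNReal.ofReal (ε ^ (θ - 1)) * D.vol) := by
  obtain ⟨F, hF, hFH, hFa, hFL⟩ := exists_contDiff_approx_of_holder hε hH hθ₀ hθ₁ hb hh
  set g : Fin k → M → ℝ := fun l x => X x (I l)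
  have hg : ∀ l, ContMDiff (𝓡 n) 𝓘(ℝ, ℝ) 1 (g l) := fun l =>
    (EuclideanSpace.proj (𝕜 := ℝ) (I l)).contDiff.contMDiff.comp hX
  have hCg : ∀ l x (v : TangentSpace (𝓡 n) x), |scalarDiff (g l) x v| ≤ C * ‖v‖ :=
    fun l => hCX (I l)
  have hFX : ContMDiff (𝓡 n) 𝓘(ℝ, ℝ) 1 fun x => χ x * F (X x) :=
    hχ.mul ((hF.of_le (by simp)).contMDiff.comp hX)
  have hL : 0 ≤ H * ε ^ (θ - 1) := by positivity
  -- Here `ε ≤ 1` is used: the term `H * C` from differentiating the cutoff is absorbed into the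
  -- order `ε ^ (θ - 1)`.
  have hε' : 1 ≤ ε ^ (θ - 1) := Real.one_le_rpow_of_pos_of_le_one_of_nonpos hε hε1 (by linarith)
  have hdiff : ∀ x, |χ x * a (X x) - χ x * F (X x)| ≤ 2 * H * ε ^ θ := fun x => by
    by_cases hx : x ∈ tsupport χ
    · rw [← mul_sub, abs_mul, abs_sub_comm]
      calc |χ x| * |F (X x) - a (X x)| ≤ 1 * (2 * H * ε ^ θ) :=
            mul_le_mul (hχ1 x) (hFa _ (hχs x hx)) (abs_nonneg _) zero_le_one
        _ = _ := one_mul _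
    · rw [image_eq_zero_of_notMem_tsupport hx, zero_mul, zero_mul, sub_zero, abs_zero]
      positivity
  have h1 := D.ofReal_abs_wedgeIntegral_le_boundaryVol hC0 hCg hdiff
  have h2 := D.ofReal_abs_wedgeIntegral_le_vol hFX hg hC0
    (Cb := H * ε ^ (θ - 1) * (n * C) + H * C) (by positivity) hCg
    (abs_scalarDiff_mul_comp_le hχ hχ1 hX hH hL hCχ hCX (hF.differentiable (by simp)) hFH hFL)
  rw [D.wedgeIntegral_sub hcont hFX.continuous hg] at h1
  have hfac : (k.factorial : ℝ) ≤ (k + 1).factorial := by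
    exact_mod_cast Nat.factorial_le (Nat.le_succ k)
  set p := D.wedgeIntegral (fun x => χ x * a (X x)) g
  set q := D.wedgeIntegral (fun x => χ x * F (X x)) g
  have hpq : |p| ≤ |p - q| + |q| := by
    have := abs_add_le (p - q) q
    rwa [sub_add_cancel] at this
  calc ENNReal.ofReal |p| ≤ ENNReal.ofReal |p - q| + ENNReal.ofReal |q| :=
        (ENNReal.ofReal_le_ofReal hpq).trans ENNReal.ofReal_add_le
    _ ≤ _ := add_le_add h1 h2
    _ ≤ _ := by
      rw [mul_add, ← mul_assoc (ENNReal.ofReal _) (ENNReal.ofReal _),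
        ← mul_assoc (ENNReal.ofReal _) (ENNReal.ofReal _), ← ENNReal.ofReal_mul (by positivity),
        ← ENNReal.ofReal_mul (by positivity)]
      refine add_le_add (mul_le_mul_left (ENNReal.ofReal_le_ofReal ?_) _)
        (mul_le_mul_left (ENNReal.ofReal_le_ofReal ?_) _)
      · calc 2 * H * ε ^ θ * (k.factorial * C ^ k)
            ≤ 2 * H * ε ^ θ * ((k + 1).factorial * C ^ k) := by gcongr
          _ = H * (2 * ((k + 1).factorial * C ^ k)) * ε ^ θ := by ring
          _ ≤ H * ((2 + n * C + C) * ((k + 1).factorial * C ^ k)) * ε ^ θ := by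
            gcongr
            have : 0 ≤ n * C := by positivity
            linarith
      · calc (H * ε ^ (θ - 1) * (n * C) + H * C) * ((k + 1).factorial * C ^ k)
            ≤ (H * ε ^ (θ - 1) * (n * C) + H * C * ε ^ (θ - 1)) *
                ((k + 1).factorial * C ^ k) := by
              refine mul_le_mul_of_nonneg_right (add_le_add le_rfl ?_) (by positivity)
              exact le_mul_of_one_le_right (by positivity) hε'
          _ = H * ((n * C + C) * ((k + 1).factorial * C ^ k)) * ε ^ (θ - 1) := by ring
          _ ≤ H * ((2 + n * C + C) * ((k + 1).factorial * C ^ k)) * ε ^ (θ - 1) := by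
            gcongr
            linarith

/-- The trivial estimate for a bounded form `χ a dx_I` supported in a chart. -/
theorem ofReal_abs_wedgeIntegral_le_of_bound {χ : M → ℝ} (hχ1 : ∀ x, |χ x| ≤ 1)
    {X : M → EuclideanSpace ℝ (Fin n)} {C H : ℝ} (hC0 : 0 ≤ C) (hH : 0 ≤ H)
    (hCX : ∀ l x (v : TangentSpace (𝓡 n) x), |scalarDiff (fun z => X z l) x v| ≤ C * ‖v‖)
    {a : EuclideanSpace ℝ (Fin n) → ℝ} {s : Set (EuclideanSpace ℝ (Fin n))}
    (hb : ∀ y ∈ s, |a y| ≤ H) (hχs : ∀ x ∈ tsupport χ, X x ∈ s) (I : Fin k → Fin n) :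
    ENNReal.ofReal |D.wedgeIntegral (fun x => χ x * a (X x)) fun l x => X x (I l)| ≤
      ENNReal.ofReal (H * ((2 + n * C + C) * ((k + 1).factorial * C ^ k))) * D.boundaryVol := by
  have hdiff : ∀ x, |χ x * a (X x)| ≤ H := fun x => by
    by_cases hx : x ∈ tsupport χ
    · rw [abs_mul]
      calc |χ x| * |a (X x)| ≤ 1 * H :=
            mul_le_mul (hχ1 x) (hb _ (hχs x hx)) (abs_nonneg _) zero_le_one
        _ = _ := one_mul _
    · rwa [image_eq_zero_of_notMem_tsupport hx, zero_mul, abs_zero]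
  have hfac : (k.factorial : ℝ) ≤ (k + 1).factorial := by
    exact_mod_cast Nat.factorial_le (Nat.le_succ k)
  refine (D.ofReal_abs_wedgeIntegral_le_boundaryVol hC0 (fun l => hCX (I l)) hdiff).trans ?_
  refine mul_le_mul_left (ENNReal.ofReal_le_ofReal (mul_le_mul_of_nonneg_left ?_ hH)) _
  calc (k.factorial : ℝ) * C ^ k ≤ (k + 1).factorial * C ^ k := by gcongr
    -- The constant is enlarged to that of the scaled estimate, so that both can enter the
    -- interpolation with the same factor.
    _ = 1 * ((k + 1).factorial * C ^ k) := (one_mul _).symm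
    _ ≤ (2 + n * C + C) * ((k + 1).factorial * C ^ k) := by
      gcongr
      have : 0 ≤ n * C := by positivity
      linarith

end ImmersedDisk

end Globalization

/-! ### Assembly -/

theorem theoremA {n : ℕ} {M : Type*} [EMetricSpace M] [CompactSpace M]
    [ChartedSpace (EuclideanSpace ℝ (Fin n)) M] [IsManifold (𝓡 n) ∞ M]
    [RiemannianBundle (fun x : M => TangentSpace (𝓡 n) x)]
    [IsContMDiffRiemannianBundle (𝓡 n) ∞ (EuclideanSpace ℝ (Fin n))
      (fun x : M => TangentSpace (𝓡 n) x)]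
    [IsRiemannianManifold (𝓡 n) M]
    (A : Set (OpenPartialHomeomorph M (EuclideanSpace ℝ (Fin n)))) (hA : IsFiniteAtlas A)
    (θ : ℝ≥0) (hθ₀ : 0 < θ) (hθ₁ : θ < 1) (k : ℕ) (hk₁ : 1 ≤ k) (hkn : k + 1 ≤ n) :
    ∃ σ K : ℝ, 0 < σ ∧ 0 < K ∧
      ∀ α : DiffForm n M k, DiffForm.holderNorm A θ α ≠ ⊤ →
        ∀ D : ImmersedDisk n M k,
          max (Metric.ediam D.boundary) D.boundaryVol < ENNReal.ofReal σ →
            ENNReal.ofReal |D.boundaryIntegral α| ≤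
              ENNReal.ofReal K * DiffForm.holderNorm A θ α *
                D.boundaryVol ^ (1 - (θ : ℝ)) * D.vol ^ (θ : ℝ) := by
  have : IsContinuousRiemannianBundle (EuclideanSpace ℝ (Fin n))
      (fun x : M => TangentSpace (𝓡 n) x) := by
    obtain ⟨g, hg, h⟩ := IsContMDiffRiemannianBundle.exists_contMDiff (IB := 𝓡 n) (n := ∞)
      (F := EuclideanSpace ℝ (Fin n)) (E := fun x : M => TangentSpace (𝓡 n) x)
    exact ⟨g, hg.continuous, h⟩
  have hM1 : IsManifold (𝓡 n) 1 M := inferInstance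
  have : Fintype A := hA.1.fintype
  have hAφ : ∀ φ : A, φ.1 ∈ IsManifold.maximalAtlas (𝓡 n) ∞ M := fun φ => hA.2.1 φ.2
  obtain ⟨χ, hχ⟩ := SmoothPartitionOfUnity.exists_isSubordinate (𝓡 n) (isClosed_univ (X := M))
    (fun φ : A => φ.1.source) (fun φ => φ.1.open_source) fun x _ => by
      obtain ⟨φ, hφ, hx⟩ := hA.2.2 x
      exact mem_iUnion.2 ⟨⟨φ, hφ⟩, hx⟩
  have hχsum : ∀ x, ∑ φ, χ φ x = 1 := fun x => by
    rw [← finsum_eq_sum_of_fintype]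
    exact χ.sum_eq_one (mem_univ x)
  have hχsm : ∀ φ, ContMDiff (𝓡 n) 𝓘(ℝ, ℝ) 1 (χ φ) := fun φ =>
    (χ φ).contMDiff.of_le (by simp)
  have hχ1 : ∀ φ x, |χ φ x| ≤ 1 := fun φ x => by
    rw [abs_of_nonneg (χ.nonneg φ x)]
    exact χ.le_one φ x
  choose X hXsm hXφ using fun φ : A =>
    exists_contMDiff_eventuallyEq_chart (hAφ φ) (isClosed_tsupport (χ φ)) (hχ φ)
  have hX1 : ∀ φ, ContMDiff (𝓡 n) (𝓡 n) 1 (X φ) := fun φ => (hXsm φ).of_le (by simp)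
  have hXt : ∀ φ, ∀ x ∈ tsupport (χ φ), X φ x ∈ φ.1.target := fun φ x hx => by
    rw [(hXφ φ x hx).eq_of_nhds]
    exact φ.1.map_source (hχ φ hx)
  choose c hc0 hc using fun φ => exists_abs_scalarDiff_le (hχsm φ)
  choose d hd0 hd using fun (φ : A) (l : Fin n) => exists_abs_scalarDiff_le
    (f := fun x => X φ x l) ((EuclideanSpace.proj (𝕜 := ℝ) l).contDiff.contMDiff.comp (hX1 φ))
  -- One constant for the differentials of all cutoffs and all extended coordinates; it depends on
  -- the metric and the atlas only.
  let C : ℝ := ∑ φ, (c φ + ∑ l, d φ l)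
  have hCφ : ∀ φ, c φ + ∑ l, d φ l ≤ C := fun φ =>
    Finset.single_le_sum (f := fun φ => c φ + ∑ l, d φ l)
      (fun φ _ => add_nonneg (hc0 φ) (Finset.sum_nonneg fun l _ => hd0 φ l)) (Finset.mem_univ φ)
  have hC0 : 0 ≤ C := Finset.sum_nonneg fun φ _ =>
    add_nonneg (hc0 φ) (Finset.sum_nonneg fun l _ => hd0 φ l)
  have hcC : ∀ φ, c φ ≤ C := fun φ =>
    (le_add_of_nonneg_right (Finset.sum_nonneg fun l _ => hd0 φ l)).trans (hCφ φ)
  have hdC : ∀ φ l, d φ l ≤ C := fun φ l =>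
    ((Finset.single_le_sum (f := fun l => d φ l) (fun l _ => hd0 φ l) (Finset.mem_univ l)).trans
      (le_add_of_nonneg_left (hc0 φ))).trans (hCφ φ)
  have hCχ : ∀ φ x (v : TangentSpace (𝓡 n) x), |scalarDiff (χ φ) x v| ≤ C * ‖v‖ :=
    fun φ x v => (hc φ x v).trans (mul_le_mul_of_nonneg_right (hcC φ) (norm_nonneg _))
  have hCX : ∀ φ l x (v : TangentSpace (𝓡 n) x), |scalarDiff (fun z => X φ z l) x v| ≤ C * ‖v‖ :=
    fun φ l x v => (hd φ l x v).trans (mul_le_mul_of_nonneg_right (hdC φ l) (norm_nonneg _))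
  let K₀ : ℝ := (2 + n * C + C) * ((k + 1).factorial * C ^ k)
  have hK₀ : 0 ≤ K₀ := by positivity
  let T : ℝ := Fintype.card A * Fintype.card (Fin k ↪o Fin n)
  have hT : 0 ≤ T := by positivity
  -- `T` counts the pairs of a chart and a multi-index, the 2 comes from the interpolation, and the
  -- summand 1 keeps `K` positive when `T * K₀ = 0`. The value 1 of `σ` is arbitrary: it serves to
  -- make `|∂D|` finite.
  refine ⟨1, 2 * (T * K₀) + 1, one_pos, by positivity, fun α hα D hD => ?_⟩
  set N := DiffForm.holderNorm A θ α with hN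
  have hNle : ∀ (φ : A) (I : Fin k ↪o Fin n),
      holderNormOn θ φ.1.target (α.coeff φ.1 I) ≤ N := fun φ I =>
    (le_iSup (fun I => holderNormOn θ φ.1.target (α.coeff φ.1 I)) I).trans
      (le_iSup₂ (f := fun ψ (_ : ψ ∈ A) => ⨆ I : Fin k ↪o Fin n,
        holderNormOn θ ψ.target (α.coeff ψ I)) φ.1 φ.2)
  have hP : D.boundaryVol ≠ ⊤ := ((le_max_right _ _).trans_lt hD).ne_top
  have hcont : ∀ (φ : A) (I : Fin k ↪o Fin n),
      Continuous fun x => χ φ x * α.coeff φ.1 I (X φ x) := fun φ I =>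
    continuous_mul_comp_of_tsupport_subset (hχsm φ).continuous (hX1 φ).continuous φ.1.open_target
      (continuousOn_of_holderNormOn_le hθ₀ hα (hNle φ I)) (hXt φ)
  have hsum := D.boundaryIntegral_eq_sum_wedgeIntegral α hAφ hχsum hχ hX1 hXφ hcont
  -- Stated for arbitrary `Q` to serve twice: with `|∂D|` for the trivial bound, and with the
  -- combination of `|∂D|` and `|D|` at each scale.
  have hZ : ∀ Q : ℝ≥0∞, (∀ (φ : A) (I : Fin k ↪o Fin n),
      ENNReal.ofReal |D.wedgeIntegral (fun x => χ φ x * α.coeff φ.1 I (X φ x))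
        fun l x => X φ x (I l)| ≤ ENNReal.ofReal (N.toReal * K₀) * Q) →
      ENNReal.ofReal |D.boundaryIntegral α| ≤ ENNReal.ofReal (T * K₀) * N * Q := by
    intro Q hQ
    rw [hsum, ← Real.enorm_eq_ofReal_abs]
    refine (enorm_sum_le _ _).trans ((Finset.sum_le_card_nsmul _ _
      (Fintype.card (Fin k ↪o Fin n) • (ENNReal.ofReal (N.toReal * K₀) * Q)) fun φ _ =>
      (enorm_sum_le _ _).trans (Finset.sum_le_card_nsmul _ _ _ fun I _ => ?_)).trans
      (le_of_eq ?_))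
    · rw [Real.enorm_eq_ofReal_abs]
      exact hQ φ I
    · rw [Finset.card_univ, nsmul_eq_mul, nsmul_eq_mul, ENNReal.ofReal_mul hT,
        ENNReal.ofReal_mul ENNReal.toReal_nonneg, ENNReal.ofReal_toReal hα,
        ENNReal.ofReal_mul (Nat.cast_nonneg _), ENNReal.ofReal_natCast, ENNReal.ofReal_natCast]
      ring
  have hθ₀' : (0 : ℝ) < θ := hθ₀
  have hθ₁' : (θ : ℝ) < 1 := hθ₁
  have hmain := le_rpow_mul_rpow_of_forall_le hθ₀' hθ₁'
    (ENNReal.mul_ne_top ENNReal.ofReal_ne_top hα) hP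
    (hZ _ fun φ I => D.ofReal_abs_wedgeIntegral_le_of_bound (hχ1 φ) hC0 ENNReal.toReal_nonneg
      (hCX φ) (fun y hy => abs_le_of_holderNormOn_le hα (hNle φ I) hy) (hXt φ) I)
    fun ε hε hε1 => hZ _ fun φ I => D.ofReal_abs_wedgeIntegral_le_of_holder (hχsm φ) (hχ1 φ)
      (hX1 φ) hC0 ENNReal.toReal_nonneg hθ₀'.le hθ₁'.le hε hε1 (hCχ φ) (hCX φ)
      (fun y hy => abs_le_of_holderNormOn_le hα (hNle φ I) hy)
      (fun y hy z hz => abs_sub_le_of_holderNormOn_le hα (hNle φ I) hy hz) (hXt φ) (hcont φ I) I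
  refine hmain.trans ?_
  have hK : 2 * (ENNReal.ofReal (T * K₀) * N) ≤ ENNReal.ofReal (2 * (T * K₀) + 1) * N := by
    rw [← mul_assoc]
    gcongr
    rw [← ENNReal.ofReal_ofNat, ← ENNReal.ofReal_mul zero_le_two]
    exact ENNReal.ofReal_le_ofReal (by linarith)
  gcongr
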